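/- Let $\epsilon\in\{-1,0,1\}$ and let $\mathbb{Q}_\epsilon^n$ be $\mathbb{H}^n$, $\mathbb{R}^n$ or $\mathbb{S}^n$ for $\epsilon=-1,0,1$ respectively. For $\epsilon=\pm1$ regard $$\mathbb{Q}_\epsilon^n\times\mathbb{R}=\{(x_0,\dots,x_{n+1}) : \epsilon x_0^2+x_1^2+\dots+x_n^2=\epsilon\}\quad(x_0>0\text{ if }\epsilon=-1)$$ as a submanifold of $\mathbb{E}^{n+2}=\mathbb{R}^{n+2}$ with the metric $\epsilon\,dx_0^2+dx_1^2+\dots+dx_{n+1}^2$; for $\epsilon=0$ identify $\mathbb{R}^n\times\mathbb{R}$ with $\{x_0=1\}\subset\mathbb{R}^{n+2}$, with its standard metric. Let $\partial/\partial t=(0,\dots,0,1)$. For an immersion $f\colon M\to\mathbb{Q}_\epsilon^n\times\mathbb{R}$, with the induced metric on $M$, let $T$ (tangent to $M$) and $\eta$ (normal to $f$ in $\mathbb{Q}_\epsilon^n\times\mathbb{R}$) be defined by $\partial/\partial t=f_*T+\eta$. *Construction.* Let $g\colon N^{m-1}\to\mathbb{Q}_\epsilon^n=\mathbb{Q}_\epsilon^n\times\{0\}$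 be a smooth isometric immersion, let $k\ge 0$, and let $\xi_1,\dots,\xi_k$ be an orthonormal set of normal vector fields along $g$ in $\mathbb{Q}_\epsilon^n$ that are parallel in the normal connection. Let $I\subset\mathbb{R}$ be an open interval and $\alpha=(\alpha_0,\dots,\alpha_{k+1})\colon I\to\mathbb{Q}_\epsilon^k\times\mathbb{R}$ a smooth curve with $\alpha_{k+1}'$ nowhere zero. (Here $\mathbb{Q}_1^0=\{1,-1\}$ and $\mathbb{Q}_\epsilon^0=\{1\}$ for $\epsilon\in\{-1,0\}$.) Set $$f\colon N^{m-1}\times I\to\mathbb{Q}_\epsilon^n\times\mathbb{R},\qquad f(x,s)=\alpha_0(s)\,g(x)+\sum_{i=1}^k\alpha_i(s)\,\xi_i(x)+\alpha_{k+1}(s)\,\frac{\partial}{\partial t}.\qquad(*)$$ *Statement.* (1) If $\alpha$ is a geodesic of $\mathbb{Q}_\epsilon^k\times\mathbb{R}$, then the map $f$ in $(*)$ is smooth with values in $\mathbb{Q}_\epsilon^n\times\mathbb{R}$, and on the open set of its regular points (the points where its differential is injective) it is an immersion whose normal vector field $\eta$ is parallel in the normal connection. (2) Conversely, let $m\ge2$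 and let $f\colon M^m\to\mathbb{Q}_\epsilon^n\times\mathbb{R}$ be a smooth isometric immersion such that $T$ is nowhere zero and $\eta$ is parallel in the normal connection. Then $f$ is locally of the form $(*)$ with $\alpha$ a geodesic: each point of $M$ has an open neighbourhood $U$ and a diffeomorphism $\psi\colon N^{m-1}\times I\to U$, where $N^{m-1}$ is a smooth manifold (which can be taken to be an open subset of $\mathbb{R}^{m-1}$), such that $f\circ\psi$ is given by $(*)$ for some $k\geq 0$, $g$, $\xi_1,\dots,\xi_k$ and $\alpha$ as in the construction, with $\alpha$ a geodesic of $\mathbb{Q}_\epsilon^k\times\mathbb{R}$. -/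

import Mathlib

open scoped Manifold ContDiff Topology

noncomputable section

/-- The ambient vector space `𝔼ⁿ⁺² = ℝ × ℝⁿ × ℝ`; a vector is `(x₀, (x₁, …, xₙ), x_{n+1})`. -/
abbrev AmbientSpace (n : ℕ) : Type := ℝ × EuclideanSpace ℝ (Fin n) × ℝ

/-- The bilinear form `⟨v, w⟩ = ε v₀ w₀ + v₁ w₁ + ⋯ + v_{n+1} w_{n+1}`. It is the Euclidean inner
product for `ε = 1` and the Lorentzian one for `ε = -1`; for `ε = 0` it is the standard inner
product on the vectors with `v₀ = 0`, the only ones to which it is then applied. -/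
def ambientForm {n : ℕ} (ε : ℝ) (v w : AmbientSpace n) : ℝ :=
  ε * (v.1 * w.1) + inner ℝ v.2.1 w.2.1 + v.2.2 * w.2.2

/-- The product `ℚ_εⁿ × ℝ` inside `𝔼ⁿ⁺²`. The equation `x₀² + ε (x₁² + ⋯ + xₙ²) = 1` is
`ε x₀² + x₁² + ⋯ + xₙ² = ε` when `ε = ±1`, so the first factor is the unit sphere `𝕊ⁿ` for `ε = 1`
and the hyperboloid sheet `ℍⁿ` for `ε = -1`; for `ε = 0` it is the affine space
`{x₀ = 1} = ℝⁿ`. -/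
def QProd (ε : ℝ) (n : ℕ) : Set (AmbientSpace n) :=
  {p | p.1 ^ 2 + ε * ‖p.2.1‖ ^ 2 = 1 ∧ (ε ≠ 1 → 0 < p.1)}

/-- The unit vector field `∂/∂t` tangent to the factor `ℝ`. -/
def ddt (n : ℕ) : AmbientSpace n := (0, 0, 1)

/-- The projection `π : 𝔼ⁿ⁺¹ × ℝ → 𝔼ⁿ⁺¹`, with values viewed in `𝔼ⁿ⁺²`. -/
def horPart {n : ℕ} (p : AmbientSpace n) : AmbientSpace n := (p.1, p.2.1, 0)

/-- Half the differential at `p`, in the direction `w`, of the function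
`x₀² + ε (x₁² + ⋯ + xₙ²)` that defines `ℚ_εⁿ × ℝ`. For `ε = ±1` it is `ε ⟨π p, w⟩`. -/
def QProdConormal {n : ℕ} (ε : ℝ) (p w : AmbientSpace n) : ℝ :=
  p.1 * w.1 + ε * inner ℝ p.2.1 w.2.1

/-- The tangent space of `ℚ_εⁿ × ℝ` at `p`. -/
def QProdTangent {n : ℕ} (ε : ℝ) (p : AmbientSpace n) : Set (AmbientSpace n) :=
  {v | QProdConormal ε p v = 0}

/-- The projection of `𝔼ⁿ⁺²` onto the tangent space of `ℚ_εⁿ × ℝ` at `p`, with kernel spanned by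
`π p`. For `ε = ±1` it is the orthogonal projection `w ↦ w - ε ⟨w, π p⟩ π p`; for `ε = 0` it is the
identity on the vectors with `w₀ = 0`. Hence the Levi-Civita connection of `ℚ_εⁿ × ℝ` is the flat
derivative followed by this projection. -/
def QProdProj {n : ℕ} (ε : ℝ) (p w : AmbientSpace n) : AmbientSpace n :=
  w - QProdConormal ε p w • horPart p

section Immersions

variable {E H : Type*} [NormedAddCommGroup E] [NormedSpace ℝ E] [TopologicalSpace H]
  (I : ModelWithCorners ℝ E H) {M : Type*} [TopologicalSpace M] [ChartedSpace H M] {n : ℕ}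

/-- The differential `f_*(x) : T_xM → 𝔼ⁿ⁺²`. -/
def diffAt (f : M → AmbientSpace n) (x : M) : TangentSpace I x →L[ℝ] AmbientSpace n :=
  mfderiv I 𝓘(ℝ, AmbientSpace n) f x

/-- The normal space at `x` of a map `f` into `ℚ_εⁿ × ℝ`: the vectors tangent to `ℚ_εⁿ × ℝ` at
`f x` that are orthogonal to `f_* T_xM`. -/
def normalSpaceAt (ε : ℝ) (f : M → AmbientSpace n) (x : M) : Set (AmbientSpace n) :=
  {v | v ∈ QProdTangent ε (f x) ∧ ∀ X : TangentSpace I x, ambientForm ε (diffAt I f x X) v = 0}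

/-- `w = f_* Y + v` is the splitting of `w` into its tangent part `f_* Y` and its normal
part `v`. -/
def IsSplittingAt (ε : ℝ) (f : M → AmbientSpace n) (x : M) (w : AmbientSpace n)
    (Y : TangentSpace I x) (v : AmbientSpace n) : Prop :=
  w = diffAt I f x Y + v ∧ v ∈ normalSpaceAt I ε f x

/-- The covariant derivative `∇̄_X V`, in the Levi-Civita connection of `ℚ_εⁿ × ℝ`, of a vector
field `V` along `f`. -/
def covDerivAlong (ε : ℝ) (f V : M → AmbientSpace n) (x : M) (X : TangentSpace I x) :
    AmbientSpace n :=
  QProdProj ε (f x) (diffAt I V x X)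

/-- On the open set `S`, `V` is a smooth normal vector field along `f` that is parallel in the
normal connection: the normal part `∇^⊥_X V` of `∇̄_X V` is zero for every tangent vector `X`. -/
structure IsParallelNormalOn (ε : ℝ) (f : M → AmbientSpace n) (S : Set M)
    (V : M → AmbientSpace n) : Prop where
  smooth : ContMDiffOn I 𝓘(ℝ, AmbientSpace n) ∞ V S
  normal : ∀ x ∈ S, V x ∈ normalSpaceAt I ε f x
  parallel : ∀ x ∈ S, ∀ X : TangentSpace I x,
    ∃ Y : TangentSpace I x, IsSplittingAt I ε f x (covDerivAlong I ε f V x X) Y 0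

/-- `f : M → ℚ_εⁿ × ℝ` is a smooth immersion; it is an isometric immersion for the metric that it
induces on `M`. -/
structure IsImmersionQProd (ε : ℝ) (f : M → AmbientSpace n) : Prop where
  smooth : ContMDiff I 𝓘(ℝ, AmbientSpace n) ∞ f
  mem : ∀ x, f x ∈ QProd ε n
  injective : ∀ x, Function.Injective (diffAt I f x)

/-- The data `g, ξ₁, …, ξ_k` of the construction: `g : N → ℚ_εⁿ = ℚ_εⁿ × {0}` is an immersion, and
the `ξᵢ` are orthonormal parallel normal vector fields along `g` in `ℚ_εⁿ`. Since `ℚ_εⁿ × {0}` is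
totally geodesic, a field tangent to it is normal (parallel) along `g` in `ℚ_εⁿ` exactly when
it is so in `ℚ_εⁿ × ℝ`. -/
structure IsTubeBase (ε : ℝ) {k : ℕ} (g : M → AmbientSpace n)
    (ξ : Fin k → M → AmbientSpace n) : Prop where
  immersion : IsImmersionQProd I ε g
  g_slice : ∀ x, (g x).2.2 = 0
  ξ_slice : ∀ i x, (ξ i x).2.2 = 0
  parallel : ∀ i, IsParallelNormalOn I ε g Set.univ (ξ i)
  orthonormal : ∀ i j x, ambientForm ε (ξ i x) (ξ j x) = if i = j then 1 else 0

end Immersions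

/-- On the open interval `J`, `α` is a smooth curve in `ℚ_ε^k × ℝ` whose last component has nowhere
vanishing derivative (so that `α` is regular). -/
structure IsTubeCurve (ε : ℝ) {k : ℕ} (α : ℝ → AmbientSpace k) (J : Set ℝ) : Prop where
  isOpen : IsOpen J
  interval : J.OrdConnected
  smooth : ContDiffOn ℝ ∞ α J
  mem : ∀ s ∈ J, α s ∈ QProd ε k
  height : ∀ s ∈ J, deriv (fun s => (α s).2.2) s ≠ 0

/-- On `J`, `α` is a geodesic of `ℚ_ε^k × ℝ`: its covariant acceleration is zero. -/
def IsGeodesicOn (ε : ℝ) {k : ℕ} (α : ℝ → AmbientSpace k) (J : Set ℝ) : Prop :=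
  ∀ s ∈ J, QProdProj ε (α s) (deriv (deriv α) s) = 0

/-- The map `f(x, s) = α₀(s) g(x) + ∑ᵢ αᵢ(s) ξᵢ(x) + α_{k+1}(s) ∂/∂t`. -/
def tubeMap {N : Type*} {n k : ℕ} (g : N → AmbientSpace n) (ξ : Fin k → N → AmbientSpace n)
    (α : ℝ → AmbientSpace k) (q : N × ℝ) : AmbientSpace n :=
  (α q.2).1 • g q.1 + ∑ i, (α q.2).2.1 i • ξ i q.1 + (α q.2).2.2 • ddt n

/-- The regular points of `f` in `N × J`: those at which the differential is injective. -/
def regularPoints {E H : Type*} [NormedAddCommGroup E] [NormedSpace ℝ E] [TopologicalSpace H]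
    (I : ModelWithCorners ℝ E H) {N : Type*} [TopologicalSpace N] [ChartedSpace H N] {n : ℕ}
    (f : N × ℝ → AmbientSpace n) (J : Set ℝ) : Set (N × ℝ) :=
  {q | q.2 ∈ J ∧ Function.Injective (diffAt (I.prod 𝓘(ℝ, ℝ)) f q)}

end

/-! Write `π` for `horPart` and `D` for the flat derivative of the ambient space.

Direct part. For fixed `x`, the vectors `g(x)`, `ξᵢ(x)`, `∂/∂t` define a linear map `frameMap` that
respects the relevant bilinear forms (`IsAdaptedFrame.conormal`, `IsAdaptedFrame.ambientForm_eq`),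
so it carries `ℚ_ε^k × ℝ` into `ℚ_εⁿ × ℝ`. Parallelism of `ξᵢ` puts `Dξᵢ` in `g_* TN`
(`IsTubeBase.exists_diffAt_eq`); hence at a regular point the image of `f_*` is `g_* TN` plus the
line of the frame image of `α'`. Thus `η` is the frame image of the part of `∂/∂t` orthogonal to
`α'`. For a geodesic, `α''` is a multiple of `πα`, so the derivative of that part lies in the span
of `α'` and `πα`. Therefore `Dη` is tangent to `f` up to a multiple of `πf`, which the projection to
`ℚ_εⁿ × ℝ` removes.

Converse. Put `c = ⟨η, η⟩ = ⟨η, ∂/∂t⟩`. Parallelism makes `Dη` tangent to `f` up to a multiple of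
`πf`, which forces `c` to be locally constant. Symmetry of the second fundamental form then shows
that the shape operator of `η` kills `T` (`IsParallelChart.fderiv_normal_of_splitting`). So along
`T` the pair `(πf, πη)` solves the linear system `D_T πf = -πη`, `D_T πη = ε c (1 - c) πf`, and the
integral curves of `T` are mapped to geodesics. The height grows along `T` at the rate `1 - c > 0`
and can serve as parameter. Undoing the (circular, hyperbolic or affine) rotation gives two first
integrals of `T`, `footPoint` and `footDirection` (`IsParallelChart.fderiv_foot_eq_zero`). In
coordinates from `exists_straightening` they depend only on the point of a height slice, and
inverting the rotation exhibits `f` as a tube over that slice: `g = πf` and, when `c > 0`, the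
single normal field `-πη / |πη|`. Hence only `k = 0` (vertical cylinders, `c = 0`) and `k = 1`
occur. -/

noncomputable section

/-! ### Linear algebra of the two bilinear forms and of adapted frames -/

section Algebra

variable {n k : ℕ} {ε : ℝ}

/-- `QProdConormal ε` as a continuous bilinear form. -/
def conormalForm (n : ℕ) (ε : ℝ) : AmbientSpace n →L[ℝ] AmbientSpace n →L[ℝ] ℝ :=
  (ContinuousLinearMap.mul ℝ ℝ).bilinearComp (.fst ℝ _ _) (.fst ℝ _ _) +
    ε • (innerSL ℝ).bilinearComp ((ContinuousLinearMap.fst ℝ _ _).comp (.snd ℝ _ _))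
      ((ContinuousLinearMap.fst ℝ _ _).comp (.snd ℝ _ _))

/-- `ambientForm ε` as a continuous bilinear form. -/
def ambientBilin (n : ℕ) (ε : ℝ) : AmbientSpace n →L[ℝ] AmbientSpace n →L[ℝ] ℝ :=
  ε • (ContinuousLinearMap.mul ℝ ℝ).bilinearComp (.fst ℝ _ _) (.fst ℝ _ _) +
    (innerSL ℝ).bilinearComp ((ContinuousLinearMap.fst ℝ _ _).comp (.snd ℝ _ _))
      ((ContinuousLinearMap.fst ℝ _ _).comp (.snd ℝ _ _)) +
    (ContinuousLinearMap.mul ℝ ℝ).bilinearComp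
      ((ContinuousLinearMap.snd ℝ _ _).comp (.snd ℝ _ _))
      ((ContinuousLinearMap.snd ℝ _ _).comp (.snd ℝ _ _))

lemma conormalForm_apply (v w : AmbientSpace n) :
    conormalForm n ε v w = QProdConormal ε v w := by
  simp [conormalForm, QProdConormal]

lemma ambientBilin_apply (v w : AmbientSpace n) :
    ambientBilin n ε v w = ambientForm ε v w := by
  simp [ambientBilin, ambientForm]

/-- The projection `horPart` as a continuous linear map. -/
def horPartL (n : ℕ) : AmbientSpace n →L[ℝ] AmbientSpace n :=
  (ContinuousLinearMap.fst ℝ _ _).prod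
    (((ContinuousLinearMap.fst ℝ _ _).comp (.snd ℝ _ _)).prod 0)

lemma horPartL_apply (v : AmbientSpace n) : horPartL n v = horPart v := rfl

/-- The height `v ↦ v_{n+1}` as a continuous linear map. -/
def heightL (n : ℕ) : AmbientSpace n →L[ℝ] ℝ :=
  (ContinuousLinearMap.snd ℝ _ _).comp (.snd ℝ _ _)

lemma heightL_apply (v : AmbientSpace n) : heightL n v = v.2.2 := rfl

lemma QProdConormal_comm (v w : AmbientSpace n) :
    QProdConormal ε v w = QProdConormal ε w v := by
  simp [QProdConormal, real_inner_comm, mul_comm]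

lemma ambientForm_comm (v w : AmbientSpace n) : ambientForm ε v w = ambientForm ε w v := by
  simp [ambientForm, real_inner_comm, mul_comm]

lemma QProdConormal_horPart_left (v w : AmbientSpace n) :
    QProdConormal ε (horPart v) w = QProdConormal ε v w := rfl

lemma QProdConormal_horPart_right (v w : AmbientSpace n) :
    QProdConormal ε v (horPart w) = QProdConormal ε v w := rfl

lemma QProdConormal_ddt_right (v : AmbientSpace n) : QProdConormal ε v (ddt n) = 0 := by
  simp [QProdConormal, ddt]

lemma ambientForm_ddt_left (v : AmbientSpace n) : ambientForm ε (ddt n) v = v.2.2 := by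
  simp [ambientForm, ddt]

lemma ambientForm_ddt_right (v : AmbientSpace n) : ambientForm ε v (ddt n) = v.2.2 := by
  simp [ambientForm, ddt]

lemma eq_horPart_add (v : AmbientSpace n) : v = horPart v + v.2.2 • ddt n := by
  ext <;> simp [horPart, ddt]

lemma ambientForm_horPart_left (v w : AmbientSpace n) :
    ambientForm ε (horPart v) w = ambientForm ε v w - v.2.2 * w.2.2 := by
  simp [ambientForm, horPart]

lemma ambientForm_horPart_right (v w : AmbientSpace n) :
    ambientForm ε v (horPart w) = ambientForm ε v w - v.2.2 * w.2.2 := by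
  simp [ambientForm, horPart]

lemma ambientForm_horPart_horPart (v w : AmbientSpace n) :
    ambientForm ε (horPart v) (horPart w) = ambientForm ε v w - v.2.2 * w.2.2 := by
  simp [ambientForm, horPart]

/-- This identity allows a uniform treatment of the three geometries: the correction `1 - ε ^ 2`
vanishes for `ε = ±1`, and for `ε = 0` only the product of the zeroth coordinates survives. -/
lemma QProdConormal_eq (v w : AmbientSpace n) :
    QProdConormal ε v w =
      ε * (ambientForm ε v w - v.2.2 * w.2.2) + (1 - ε ^ 2) * v.1 * w.1 := by
  simp only [QProdConormal, ambientForm]; ring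

lemma QProdConormal_self {p : AmbientSpace n} (hp : p ∈ QProd ε n) :
    QProdConormal ε p p = 1 := by
  have := hp.1
  simp only [QProdConormal, real_inner_self_eq_norm_sq]
  linarith

lemma fst_eq_zero_of_tangent (hε : ε = -1 ∨ ε = 0 ∨ ε = 1) {p v : AmbientSpace n}
    (hp : p ∈ QProd ε n) (hv : v ∈ QProdTangent ε p) : (1 - ε ^ 2) * v.1 = 0 := by
  rcases hε with rfl | rfl | rfl
  · norm_num
  · have h0 : 0 < p.1 := hp.2 (by norm_num)
    have : p.1 * v.1 = 0 := by simpa [QProdTangent, QProdConormal] using hv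
    simpa using (mul_eq_zero.1 this).resolve_left h0.ne'
  · norm_num

lemma QProdConormal_of_tangent (hε : ε = -1 ∨ ε = 0 ∨ ε = 1) {p v : AmbientSpace n}
    (hp : p ∈ QProd ε n) (hv : v ∈ QProdTangent ε p) (w : AmbientSpace n) :
    QProdConormal ε v w = ε * (ambientForm ε v w - v.2.2 * w.2.2) := by
  rw [QProdConormal_eq, fst_eq_zero_of_tangent hε hp hv]; ring

lemma ambientForm_horPart_tangent {p v : AmbientSpace n} (hv : v ∈ QProdTangent ε p) :
    ε * ambientForm ε (horPart p) v = -((1 - ε ^ 2) * p.1 * v.1) := by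
  have hv' : QProdConormal ε p v = 0 := hv
  rw [QProdConormal_eq] at hv'
  rw [ambientForm_horPart_left]; linarith

/-- The factor `ε` cannot be dropped: in the flat case the position vector is not orthogonal to the
tangent space. -/
lemma horPart_ambientForm_eq_zero (hε : ε = -1 ∨ ε = 0 ∨ ε = 1) {p v : AmbientSpace n}
    (hp : p ∈ QProd ε n) (hv : v ∈ QProdTangent ε p) :
    ε * ambientForm ε v (horPart p) = 0 := by
  rw [ambientForm_comm, ambientForm_horPart_tangent hv]
  linear_combination -p.1 * fst_eq_zero_of_tangent hε hp hv

lemma horPart_mem_QProd {p : AmbientSpace n} (hp : p ∈ QProd ε n) : horPart p ∈ QProd ε n := hp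

/-- Only `ε = -1` needs an argument: the ambient form is Lorentzian there, but `p` is timelike, and
Cauchy–Schwarz makes the form definite on the complement of `p`. -/
lemma ambientForm_self_nonneg (hε : ε = -1 ∨ ε = 0 ∨ ε = 1) {p v : AmbientSpace n}
    (hp : p ∈ QProd ε n) (hv : v ∈ QProdTangent ε p) :
    0 ≤ ambientForm ε v v ∧ (ambientForm ε v v = 0 → v = 0) := by
  obtain ⟨v0, v1, v2⟩ := v
  obtain ⟨p0, p1, p2⟩ := p
  have hp1 : p0 ^ 2 + ε * ‖p1‖ ^ 2 = 1 := hp.1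
  have hv1 : p0 * v0 + ε * inner ℝ p1 v1 = 0 := hv
  have key : ambientForm ε (v0, v1, v2) (v0, v1, v2) = ε * v0 ^ 2 + ‖v1‖ ^ 2 + v2 ^ 2 := by
    simp only [ambientForm, real_inner_self_eq_norm_sq]; ring
  rw [key]
  suffices h : 0 ≤ ε * v0 ^ 2 + ‖v1‖ ^ 2 ∧ (ε * v0 ^ 2 + ‖v1‖ ^ 2 ≤ 0 → v0 = 0 ∧ v1 = 0) by
    refine ⟨by nlinarith [h.1, sq_nonneg v2], fun h0 => ?_⟩
    obtain ⟨rfl, rfl⟩ := h.2 (by nlinarith [h.1, sq_nonneg v2])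
    have : v2 = 0 := by simpa using h0
    simp [this]
  rcases hε with rfl | rfl | rfl
  · have hcs : (inner ℝ p1 v1) ^ 2 ≤ ‖p1‖ ^ 2 * ‖v1‖ ^ 2 := by
      rw [← mul_pow, ← sq_abs]
      exact pow_le_pow_left₀ (abs_nonneg _) (abs_real_inner_le_norm _ _) 2
    have e1 : inner ℝ p1 v1 = p0 * v0 := by linarith
    rw [e1] at hcs
    have hp0 : 1 ≤ p0 ^ 2 := by nlinarith [sq_nonneg ‖p1‖]
    have h2 : ‖v1‖ ^ 2 ≤ p0 ^ 2 * (‖v1‖ ^ 2 - v0 ^ 2) := by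
      have : ‖p1‖ ^ 2 = p0 ^ 2 - 1 := by linarith
      rw [this] at hcs
      nlinarith
    -- A negative difference would make the right side of `h2` negative, since `p0 ^ 2 ≥ 1`, while
    -- its left side is a square.
    have hnn : 0 ≤ ‖v1‖ ^ 2 - v0 ^ 2 := by
      by_contra hneg
      push Not at hneg
      nlinarith [sq_nonneg ‖v1‖]
    refine ⟨by linarith, fun h => ?_⟩
    have h3 : ‖v1‖ ^ 2 - v0 ^ 2 = 0 := by linarith
    rw [h3] at h2
    have h4 : ‖v1‖ ^ 2 = 0 := by nlinarith [sq_nonneg ‖v1‖]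
    exact ⟨by nlinarith, by simpa using h4⟩
  · have h0 : 0 < p0 := hp.2 (by norm_num)
    have : v0 = 0 := by
      have : p0 * v0 = 0 := by linarith
      exact (mul_eq_zero.1 this).resolve_left h0.ne'
    refine ⟨by nlinarith [sq_nonneg ‖v1‖], fun h => ⟨this, ?_⟩⟩
    have : ‖v1‖ ^ 2 = 0 := by nlinarith [sq_nonneg ‖v1‖]
    simpa using this
  · refine ⟨by positivity, fun h => ?_⟩
    have h1 : ‖v1‖ ^ 2 = 0 := by nlinarith [sq_nonneg ‖v1‖, sq_nonneg v0]
    have h2 : v0 ^ 2 = 0 := by nlinarith [sq_nonneg ‖v1‖, sq_nonneg v0]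
    exact ⟨by simpa using h2, by simpa using h1⟩

lemma ambientForm_self_pos (hε : ε = -1 ∨ ε = 0 ∨ ε = 1) {p v : AmbientSpace n}
    (hp : p ∈ QProd ε n) (hv : v ∈ QProdTangent ε p) (h0 : v ≠ 0) : 0 < ambientForm ε v v :=
  lt_of_le_of_ne (ambientForm_self_nonneg hε hp hv).1
    fun h => h0 ((ambientForm_self_nonneg hε hp hv).2 h.symm)

/-- On the hyperboloid sheet, a vector satisfying the quadratic equation that has negative product
with a point of the sheet belongs to the sheet. -/
lemma fst_pos_of_QProdConormal_pos {p q : AmbientSpace n} (hp : p ∈ QProd (-1) n)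
    (hq : q.1 ^ 2 + (-1) * ‖q.2.1‖ ^ 2 = 1) (h : 0 < QProdConormal (-1) p q) : 0 < q.1 := by
  have hp0 : 0 < p.1 := hp.2 (by norm_num)
  have hp1 := hp.1
  by_contra hneg
  push Not at hneg
  have e : QProdConormal (-1) p q = p.1 * q.1 - inner ℝ p.2.1 q.2.1 := by
    simp [QProdConormal]; ring
  -- Both points are timelike, so if `q` were on the lower sheet the spatial product could not
  -- outweigh `p.1 * q.1`, and the pairing would be nonpositive.
  have h1 : ‖p.2.1‖ < p.1 := by
    apply lt_of_pow_lt_pow_left₀ 2 hp0.le; linarith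
  have h2 : ‖q.2.1‖ < -q.1 := by
    apply lt_of_pow_lt_pow_left₀ 2 (by linarith)
    rw [neg_sq]; linarith
  have h3 := abs_le.1 (abs_real_inner_le_norm p.2.1 q.2.1)
  have h4 : ‖p.2.1‖ * ‖q.2.1‖ ≤ p.1 * (-q.1) :=
    mul_le_mul h1.le h2.le (norm_nonneg _) hp0.le
  rw [e] at h
  linarith [h3.1]

/-- The linear map `(a₀, …, a_{k+1}) ↦ a₀ G + ∑ᵢ aᵢ Ξᵢ + a_{k+1} ∂/∂t`. -/
def frameMap (G : AmbientSpace n) (Ξ : Fin k → AmbientSpace n) (a : AmbientSpace k) :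
    AmbientSpace n :=
  a.1 • G + ∑ i, a.2.1 i • Ξ i + a.2.2 • ddt n

lemma tubeMap_eq_frameMap {N : Type*} (g : N → AmbientSpace n) (ξ : Fin k → N → AmbientSpace n)
    (α : ℝ → AmbientSpace k) (q : N × ℝ) :
    tubeMap g ξ α q = frameMap (g q.1) (fun i => ξ i q.1) (α q.2) := rfl

variable {G : AmbientSpace n} {Ξ : Fin k → AmbientSpace n}

lemma frameMap_add (a b : AmbientSpace k) :
    frameMap G Ξ (a + b) = frameMap G Ξ a + frameMap G Ξ b := by
  simp only [frameMap, Prod.fst_add, Prod.snd_add, PiLp.add_apply, add_smul,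
    Finset.sum_add_distrib]
  abel

lemma frameMap_smul (c : ℝ) (a : AmbientSpace k) :
    frameMap G Ξ (c • a) = c • frameMap G Ξ a := by
  simp only [frameMap, Prod.smul_fst, Prod.smul_snd, PiLp.smul_apply, smul_add, Finset.smul_sum,
    smul_smul, smul_eq_mul]

lemma frameMap_sub (a b : AmbientSpace k) :
    frameMap G Ξ (a - b) = frameMap G Ξ a - frameMap G Ξ b := by
  rw [sub_eq_add_neg, ← neg_one_smul ℝ b, frameMap_add, frameMap_smul]
  simp [sub_eq_add_neg]

lemma frameMap_ddt : frameMap G Ξ (ddt k) = ddt n := by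
  simp [frameMap, ddt]

lemma frameMap_height (hG : G.2.2 = 0) (hΞ : ∀ i, (Ξ i).2.2 = 0) (a : AmbientSpace k) :
    (frameMap G Ξ a).2.2 = a.2.2 := by
  rw [← heightL_apply, frameMap, map_add, map_add, map_sum]
  simp [heightL_apply, hG, hΞ, ddt]

lemma frameMap_horPart (hG : G.2.2 = 0) (hΞ : ∀ i, (Ξ i).2.2 = 0) (a : AmbientSpace k) :
    frameMap G Ξ (horPart a) = horPart (frameMap G Ξ a) := by
  have e := eq_horPart_add a
  have h1 : frameMap G Ξ a = frameMap G Ξ (horPart a) + a.2.2 • ddt n := by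
    conv_lhs => rw [e]
    rw [frameMap_add, frameMap_smul, frameMap_ddt]
  have h2 := eq_horPart_add (frameMap G Ξ a)
  rw [frameMap_height hG hΞ] at h2
  exact add_right_cancel (h1.symm.trans h2)

/-- The algebraic conditions on `(G, Ξ) = (g(x), (ξᵢ(x))ᵢ)`. -/
structure IsAdaptedFrame (ε : ℝ) (G : AmbientSpace n) (Ξ : Fin k → AmbientSpace n) : Prop where
  mem : G ∈ QProd ε n
  height : G.2.2 = 0
  heights : ∀ i, (Ξ i).2.2 = 0
  tangent : ∀ i, Ξ i ∈ QProdTangent ε G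
  orthonormal : ∀ i j, ambientForm ε (Ξ i) (Ξ j) = if i = j then 1 else 0

/-- The frame has the same Gram matrix for this form as the standard basis: `1` on `G`, `ε` on each
`Ξ i`, `0` on `∂/∂t`. No tangency of `a`, `b` is required, even for `ε = 0`. -/
lemma IsAdaptedFrame.conormal (hε : ε = -1 ∨ ε = 0 ∨ ε = 1) (h : IsAdaptedFrame ε G Ξ)
    (a b : AmbientSpace k) :
    QProdConormal ε (frameMap G Ξ a) (frameMap G Ξ b) = QProdConormal ε a b := by
  have h1 : ∀ i j, QProdConormal ε (Ξ i) (Ξ j) = if i = j then ε else 0 := by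
    intro i j
    rw [QProdConormal_of_tangent hε h.mem (h.tangent i), h.orthonormal, h.heights i]
    split_ifs <;> simp
  have h2 : ∀ i, QProdConormal ε G (Ξ i) = 0 := h.tangent
  have h3 : ∀ i, QProdConormal ε (Ξ i) G = 0 := fun i => by rw [QProdConormal_comm, h2]
  have h4 : ∀ w, QProdConormal ε (ddt n) w = 0 := fun w => by
    rw [QProdConormal_comm, QProdConormal_ddt_right]
  rw [← conormalForm_apply, frameMap, frameMap]
  simp only [map_add, map_smul, map_sum, add_apply,
    sum_apply, smul_apply, conormalForm_apply, h1, h2, h3,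
    h4, QProdConormal_ddt_right, QProdConormal_self h.mem, smul_eq_mul]
  simp only [QProdConormal, PiLp.inner_apply, mul_ite, mul_zero, Finset.sum_const_zero,
    Finset.mul_sum, RCLike.inner_apply, conj_trivial,
    mul_one, add_zero, zero_add]
  congr 1
  · ring
  · simp only [Finset.sum_ite_eq', Finset.mem_univ, if_true]
    exact Finset.sum_congr rfl fun i _ => by ring

/-- For `ε = ±1` the metric is recovered from the conormal form by cancelling `ε`. For `ε = 0` the
length of `G` is arbitrary, and tangency removes the `G` component of both arguments. -/
lemma IsAdaptedFrame.ambientForm_eq (hε : ε = -1 ∨ ε = 0 ∨ ε = 1) (h : IsAdaptedFrame ε G Ξ)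
    {α a b : AmbientSpace k} (hα : α ∈ QProd ε k) (ha : a ∈ QProdTangent ε α)
    (hb : b ∈ QProdTangent ε α) :
    ambientForm ε (frameMap G Ξ a) (frameMap G Ξ b) = ambientForm ε a b := by
  have hε' : ε ≠ 0 ∨ ε = 0 := ne_or_eq _ _
  rcases hε' with h0 | rfl
  · have hs : 1 - ε ^ 2 = 0 := by rcases hε with rfl | rfl | rfl <;> simp_all
    have := h.conormal hε a b
    rw [QProdConormal_eq, QProdConormal_eq, hs, frameMap_height h.height h.heights,
      frameMap_height h.height h.heights] at this
    have := mul_left_cancel₀ h0 (by simpa using this)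
    linarith
  · have ha0 : a.1 = 0 := by simpa using fst_eq_zero_of_tangent hε hα ha
    have hb0 : b.1 = 0 := by simpa using fst_eq_zero_of_tangent hε hα hb
    have h4 : ∀ i, ambientForm 0 (ddt n) (Ξ i) = 0 := fun i => by
      rw [ambientForm_ddt_left, h.heights i]
    have h5 : ambientForm 0 (ddt n) (ddt n) = 1 := by simp [ambientForm, ddt]
    rw [← ambientBilin_apply, frameMap, frameMap, ha0, hb0]
    simp only [map_add, map_smul, map_sum, add_apply, sum_apply, smul_apply, ambientBilin_apply,
      h.orthonormal, h4, h5, ambientForm_ddt_right, h.heights, smul_eq_mul, zero_smul, zero_add]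
    simp only [ambientForm, PiLp.inner_apply, mul_ite, mul_zero, Finset.sum_const_zero,
      RCLike.inner_apply, conj_trivial, mul_one, add_zero, zero_add, Finset.sum_ite_eq',
      Finset.mem_univ, if_true, zero_mul]
    congr 1
    ring

lemma IsAdaptedFrame.mem_QProd (hε : ε = -1 ∨ ε = 0 ∨ ε = 1) (h : IsAdaptedFrame ε G Ξ)
    {a : AmbientSpace k} (ha : a ∈ QProd ε k) : frameMap G Ξ a ∈ QProd ε n := by
  have e : QProdConormal ε (frameMap G Ξ a) (frameMap G Ξ a) = 1 := by
    rw [h.conormal hε, QProdConormal_self ha]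
  have e1 : (frameMap G Ξ a).1 ^ 2 + ε * ‖(frameMap G Ξ a).2.1‖ ^ 2 = 1 := by
    simp only [QProdConormal, real_inner_self_eq_norm_sq] at e; linarith
  -- Pairing with `G` recovers the coefficient `a.1`, whose sign selects the correct sheet.
  have hG : G = frameMap G Ξ (1, 0, 0) := by simp [frameMap]
  have e2 : QProdConormal ε G (frameMap G Ξ a) = a.1 := by
    conv_lhs => rw [hG]
    have := h.conormal hε (1, 0, 0) a
    rw [← hG] at this ⊢
    rw [this]
    simp [QProdConormal]
  refine ⟨e1, fun hne => ?_⟩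
  have ha0 := ha.2 hne
  rcases hε with rfl | rfl | rfl
  · exact fst_pos_of_QProdConormal_pos h.mem e1 (e2 ▸ ha0)
  · have hG0 : 0 < G.1 := h.mem.2 hne
    have : G.1 * (frameMap G Ξ a).1 = a.1 := by simpa [QProdConormal] using e2
    exact pos_of_mul_pos_right (this ▸ ha0) hG0.le
  · exact absurd rfl hne

end Algebra

/-! ### Derivatives of maps into the ambient space and of the tube map -/

section Calculus

variable {E H : Type*} [NormedAddCommGroup E] [NormedSpace ℝ E] [TopologicalSpace H]
  {I : ModelWithCorners ℝ E H} {M : Type*} [TopologicalSpace M] [ChartedSpace H M] {n k : ℕ}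
  {ε : ℝ}

lemma HasMFDerivAt.bilinear {F G W : Type*} [NormedAddCommGroup F] [NormedSpace ℝ F]
    [NormedAddCommGroup G] [NormedSpace ℝ G] [NormedAddCommGroup W] [NormedSpace ℝ W]
    (B : F →L[ℝ] G →L[ℝ] W) {u : M → F} {v : M → G} {x : M}
    {u' : E →L[ℝ] F} {v' : E →L[ℝ] G}
    (hu : HasMFDerivAt I 𝓘(ℝ, F) u x u') (hv : HasMFDerivAt I 𝓘(ℝ, G) v x v') :
    HasMFDerivAt I 𝓘(ℝ, W) (fun y => B (u y) (v y)) x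
      (B.precompR E (u x) v' + B.precompL E u' (v x)) := by
  have hx : (extChartAt I x).symm (extChartAt I x x) = x := extChartAt_to_inv x
  have h := B.hasFDerivWithinAt_of_bilinear hu.2 hv.2
  refine ⟨ContinuousAt.comp (g := fun p : F × G => B p.1 p.2)
    B.isBoundedBilinearMap.continuous.continuousAt (hu.1.prodMk hv.1), ?_⟩
  simp only [writtenInExtChartAt, extChartAt_model_space_eq_id, Function.comp_apply, hx,
    PartialEquiv.refl_coe, id_eq] at h ⊢
  exact h

/-- Leibniz rule for a locally constant pairing; with the conormal form it differentiates both the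
equation of `ℚ_εⁿ × ℝ` and the tangency of fields along `f`. -/
lemma bilinear_mfderiv_add_eq_zero {F G : Type*} [NormedAddCommGroup F] [NormedSpace ℝ F]
    [NormedAddCommGroup G] [NormedSpace ℝ G]
    (B : F →L[ℝ] G →L[ℝ] ℝ) {u : M → F} {v : M → G} {x : M} {c : ℝ}
    (hu : MDifferentiableAt I 𝓘(ℝ, F) u x) (hv : MDifferentiableAt I 𝓘(ℝ, G) v x)
    (hc : ∀ᶠ y in 𝓝 x, B (u y) (v y) = c) (X : TangentSpace I x) :
    B (u x) (mfderiv I 𝓘(ℝ, G) v x X) + B (mfderiv I 𝓘(ℝ, F) u x X) (v x) = 0 := by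
  have h1 := HasMFDerivAt.bilinear B hu.hasMFDerivAt hv.hasMFDerivAt
  have h2 : HasMFDerivAt I 𝓘(ℝ, ℝ) (fun y => B (u y) (v y)) x 0 :=
    (hasMFDerivAt_const c x).congr_of_eventuallyEq hc
  exact DFunLike.congr_fun (hasMFDerivAt_unique h1 h2) X

lemma mfderiv_clm_comp {F W : Type*} [NormedAddCommGroup F] [NormedSpace ℝ F]
    [NormedAddCommGroup W] [NormedSpace ℝ W] (L : F →L[ℝ] W) {u : M → F} {x : M}
    (hu : MDifferentiableAt I 𝓘(ℝ, F) u x) (X : TangentSpace I x) :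
    mfderiv I 𝓘(ℝ, W) (fun y => L (u y)) x X = L (mfderiv I 𝓘(ℝ, F) u x X) :=
  DFunLike.congr_fun (L.hasFDerivAt.hasMFDerivAt.comp x hu.hasMFDerivAt).mfderiv X

lemma diffAt_mem_tangent {f : M → AmbientSpace n} {x : M}
    (hf : MDifferentiableAt I 𝓘(ℝ, AmbientSpace n) f x) (hQ : ∀ᶠ y in 𝓝 x, f y ∈ QProd ε n)
    (X : TangentSpace I x) : diffAt I f x X ∈ QProdTangent ε (f x) := by
  have h := bilinear_mfderiv_add_eq_zero (conormalForm n ε) hf hf (c := 1)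
    (hQ.mono fun y hy => by rw [conormalForm_apply, QProdConormal_self hy]) X
  have h' : QProdConormal ε (f x) (diffAt I f x X) + QProdConormal ε (diffAt I f x X) (f x) = 0 := by
    rw [← conormalForm_apply, ← conormalForm_apply]; exact h
  rw [QProdConormal_comm _ (f x)] at h'
  change QProdConormal ε (f x) (diffAt I f x X) = 0
  linarith

/-- This computes the component of the flat derivative along the position vector, that is, exactly
what `QProdProj` removes. -/
lemma conormal_diffAt {f V : M → AmbientSpace n} {x : M}
    (hf : MDifferentiableAt I 𝓘(ℝ, AmbientSpace n) f x)
    (hV : MDifferentiableAt I 𝓘(ℝ, AmbientSpace n) V x)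
    (hT : ∀ᶠ y in 𝓝 x, V y ∈ QProdTangent ε (f y)) (X : TangentSpace I x) :
    QProdConormal ε (f x) (diffAt I V x X) = -QProdConormal ε (diffAt I f x X) (V x) := by
  have h := bilinear_mfderiv_add_eq_zero (conormalForm n ε) hf hV (c := 0)
    (hT.mono fun y hy => by rw [conormalForm_apply]; exact hy) X
  rw [← conormalForm_apply, ← conormalForm_apply]
  exact eq_neg_of_add_eq_zero_left h

lemma height_diffAt {V : M → AmbientSpace n} {x : M} {c : ℝ}
    (hV : MDifferentiableAt I 𝓘(ℝ, AmbientSpace n) V x)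
    (hT : ∀ᶠ y in 𝓝 x, (V y).2.2 = c) (X : TangentSpace I x) :
    (diffAt I V x X).2.2 = 0 := by
  have h := mfderiv_clm_comp (heightL n) hV X
  have h2 : HasMFDerivAt I 𝓘(ℝ, ℝ) (fun y => heightL n (V y)) x 0 :=
    (hasMFDerivAt_const c x).congr_of_eventuallyEq hT
  rw [h2.mfderiv] at h
  exact h.symm

lemma hasFDerivAt_frameMap (a : AmbientSpace k) (G : AmbientSpace n)
    (Ξ : Fin k → AmbientSpace n) :
    ∃ L : (AmbientSpace k × AmbientSpace n × (Fin k → AmbientSpace n)) →L[ℝ] AmbientSpace n,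
      HasFDerivAt (fun z : AmbientSpace k × AmbientSpace n × (Fin k → AmbientSpace n) =>
        frameMap z.2.1 z.2.2 z.1) L (a, G, Ξ) ∧
      ∀ a' G' Ξ', L (a', G', Ξ') =
        a.1 • G' + ∑ i, a.2.1 i • Ξ' i + frameMap G Ξ a' := by
  let A : AmbientSpace k × AmbientSpace n × (Fin k → AmbientSpace n) →L[ℝ]
      AmbientSpace k := .fst ℝ _ _
  let A0 : AmbientSpace k × AmbientSpace n × (Fin k → AmbientSpace n) →L[ℝ] ℝ :=
    (ContinuousLinearMap.fst ℝ _ _).comp A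
  let Ai : Fin k → AmbientSpace k × AmbientSpace n × (Fin k → AmbientSpace n) →L[ℝ] ℝ :=
    fun i => (EuclideanSpace.proj i).comp
    (((ContinuousLinearMap.fst ℝ _ _).comp (.snd ℝ _ _)).comp A)
  let At : AmbientSpace k × AmbientSpace n × (Fin k → AmbientSpace n) →L[ℝ] ℝ :=
    (heightL k).comp A
  let Gl : AmbientSpace k × AmbientSpace n × (Fin k → AmbientSpace n) →L[ℝ]
      AmbientSpace n := (ContinuousLinearMap.fst ℝ _ _).comp (.snd ℝ _ _)
  let Xi : Fin k → AmbientSpace k × AmbientSpace n × (Fin k → AmbientSpace n) →L[ℝ]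
      AmbientSpace n := fun i => (ContinuousLinearMap.proj i).comp
    ((ContinuousLinearMap.snd ℝ _ _).comp (.snd ℝ _ _))
  have h : HasFDerivAt (fun z : AmbientSpace k × AmbientSpace n × (Fin k → AmbientSpace n) =>
      A0 z • Gl z + ∑ i, Ai i z • Xi i z + At z • ddt n) _
      (a, G, Ξ) :=
    ((A0.hasFDerivAt.fun_smul Gl.hasFDerivAt).add
      (HasFDerivAt.fun_sum fun i _ => (Ai i).hasFDerivAt.fun_smul (Xi i).hasFDerivAt)).add
      (At.hasFDerivAt.smul_const (ddt n))
  refine ⟨_, h, fun a' G' Ξ' => ?_⟩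
  simp [A0, Ai, At, Gl, Xi, A, frameMap, heightL_apply, Finset.sum_add_distrib]
  abel

lemma contDiff_frameMap :
    ContDiff ℝ ∞ (fun z : AmbientSpace k × AmbientSpace n × (Fin k → AmbientSpace n) =>
        frameMap z.2.1 z.2.2 z.1) := by
  unfold frameMap
  have : ∀ i : Fin k, ContDiff ℝ ∞
      (fun z : AmbientSpace k × AmbientSpace n × (Fin k → AmbientSpace n) => z.1.2.1 i) := by
    intro i
    exact (EuclideanSpace.proj (𝕜 := ℝ) i).contDiff.comp
      (contDiff_fst.comp (contDiff_snd.comp contDiff_fst))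
  fun_prop

variable {g : M → AmbientSpace n} {ξ : Fin k → M → AmbientSpace n} {α : ℝ → AmbientSpace k}

lemma hasMFDerivAt_tubeMap {x : M} {s : ℝ} (hg : MDifferentiableAt I 𝓘(ℝ, AmbientSpace n) g x)
    (hξ : ∀ i, MDifferentiableAt I 𝓘(ℝ, AmbientSpace n) (ξ i) x) (hα : DifferentiableAt ℝ α s) :
    MDifferentiableAt (I.prod 𝓘(ℝ, ℝ)) 𝓘(ℝ, AmbientSpace n) (tubeMap g ξ α) (x, s) ∧
    ∀ X : TangentSpace (I.prod 𝓘(ℝ, ℝ)) (x, s),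
      diffAt (I.prod 𝓘(ℝ, ℝ)) (tubeMap g ξ α) (x, s) X =
      (α s).1 • diffAt I g x X.1 + ∑ i, (α s).2.1 i • diffAt I (ξ i) x X.1 +
        X.2 • frameMap (g x) (fun i => ξ i x) (deriv α s) := by
  obtain ⟨L, hL, hL'⟩ := hasFDerivAt_frameMap (α s) (g x) (fun i => ξ i x)
  have h1 := (hasMFDerivAt_fst (I := I) (I' := 𝓘(ℝ, ℝ)) ((x, s) : M × ℝ))
  have h2 := (hasMFDerivAt_snd (I := I) (I' := 𝓘(ℝ, ℝ)) ((x, s) : M × ℝ))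
  have hg' := hg.hasMFDerivAt.comp (x, s) h1
  have hξ' := fun i => (hξ i).hasMFDerivAt.comp (x, s) h1
  have hα' := hα.hasDerivAt.hasFDerivAt.hasMFDerivAt.comp (x, s) h2
  have h3 : HasMFDerivAt (I.prod 𝓘(ℝ, ℝ)) 𝓘(ℝ, Fin k → AmbientSpace n)
      (fun q : M × ℝ => fun i => ξ i q.1) (x, s) (ContinuousLinearMap.pi fun i =>
        (mfderiv I 𝓘(ℝ, AmbientSpace n) (ξ i) x).comp
          (ContinuousLinearMap.fst ℝ (TangentSpace I x) (TangentSpace 𝓘(ℝ, ℝ) s))) :=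
    ⟨continuousAt_pi.2 fun i => (hξ' i).1, hasFDerivWithinAt_pi.2 fun i => (hξ' i).2⟩
  have h4 : HasMFDerivAt (I.prod 𝓘(ℝ, ℝ))
      𝓘(ℝ, AmbientSpace k × AmbientSpace n × (Fin k → AmbientSpace n))
      (fun q : M × ℝ => (α q.2, g q.1, fun i => ξ i q.1)) (x, s) _ :=
    ⟨hα'.1.prodMk (hg'.1.prodMk h3.1), hα'.2.prodMk (hg'.2.prodMk h3.2)⟩
  have h5 := hL.hasMFDerivAt.comp (x, s) h4
  refine ⟨h5.mdifferentiableAt, fun X => ?_⟩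
  have h6 : diffAt (I.prod 𝓘(ℝ, ℝ)) (tubeMap g ξ α) (x, s) X =
      L (X.2 • deriv α s, diffAt I g x X.1, fun i => diffAt I (ξ i) x X.1) :=
    DFunLike.congr_fun h5.mfderiv X
  rw [h6, hL', frameMap_smul]

lemma contMDiffOn_tubeMap {J : Set ℝ} (hg : ContMDiff I 𝓘(ℝ, AmbientSpace n) ∞ g)
    (hξ : ∀ i, ContMDiff I 𝓘(ℝ, AmbientSpace n) ∞ (ξ i)) (hα : ContDiffOn ℝ ∞ α J) :
    ContMDiffOn (I.prod 𝓘(ℝ, ℝ)) 𝓘(ℝ, AmbientSpace n) ∞ (tubeMap g ξ α) (Set.univ ×ˢ J) := by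
  have h1 : ContMDiffOn (I.prod 𝓘(ℝ, ℝ)) 𝓘(ℝ, AmbientSpace k) ∞
      (fun q : M × ℝ => α q.2) (Set.univ ×ˢ J) :=
    hα.contMDiffOn.comp contMDiff_snd.contMDiffOn fun q hq => hq.2
  have h2 : ContMDiff (I.prod 𝓘(ℝ, ℝ)) 𝓘(ℝ, Fin k → AmbientSpace n) ∞
      (fun q : M × ℝ => fun i => ξ i q.1) :=
    contMDiff_pi_space.2 fun i => (hξ i).comp contMDiff_fst
  exact contDiff_frameMap.contMDiff.comp_contMDiffOn
    (h1.prodMk_space ((hg.comp contMDiff_fst).prodMk_space h2).contMDiffOn)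

end Calculus

/-! ### Consequences of parallelism of the `ξᵢ` -/

section TubeBase

variable {E H : Type*} [NormedAddCommGroup E] [NormedSpace ℝ E] [TopologicalSpace H]
  {I : ModelWithCorners ℝ E H} {M : Type*} [TopologicalSpace M] [ChartedSpace H M] {n k : ℕ}
  {ε : ℝ} {g : M → AmbientSpace n} {ξ : Fin k → M → AmbientSpace n}

lemma IsImmersionQProd.mdifferentiableAt {f : M → AmbientSpace n} (h : IsImmersionQProd I ε f)
    (x : M) : MDifferentiableAt I 𝓘(ℝ, AmbientSpace n) f x :=
  h.smooth.mdifferentiable (by simp) x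

lemma IsTubeBase.mdifferentiableAt_normal (h : IsTubeBase I ε g ξ) (i : Fin k) (x : M) :
    MDifferentiableAt I 𝓘(ℝ, AmbientSpace n) (ξ i) x :=
  (contMDiffOn_univ.1 (h.parallel i).smooth).mdifferentiable (by simp) x

lemma IsTubeBase.isAdaptedFrame (h : IsTubeBase I ε g ξ) (x : M) :
    IsAdaptedFrame ε (g x) (fun i => ξ i x) where
  mem := h.immersion.mem x
  height := h.g_slice x
  heights i := h.ξ_slice i x
  tangent i := ((h.parallel i).normal x trivial).1
  orthonormal i j := h.orthonormal i j x

lemma IsTubeBase.tangent (h : IsTubeBase I ε g ξ) (x : M) (X : TangentSpace I x) :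
    diffAt I g x X ∈ QProdTangent ε (g x) :=
  diffAt_mem_tangent (h.immersion.mdifferentiableAt x) (.of_forall h.immersion.mem) X

lemma IsTubeBase.height_diffAt (h : IsTubeBase I ε g ξ) (x : M) (X : TangentSpace I x) :
    (diffAt I g x X).2.2 = 0 :=
  _root_.height_diffAt (h.immersion.mdifferentiableAt x) (.of_forall h.g_slice) X

lemma IsTubeBase.orthogonal (h : IsTubeBase I ε g ξ) (i : Fin k) (x : M) (X : TangentSpace I x) :
    ambientForm ε (diffAt I g x X) (ξ i x) = 0 :=
  ((h.parallel i).normal x trivial).2 X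

/-- The position component of the flat derivative of `ξ i` is a multiple of `⟨g_* X, ξ i⟩ = 0`, so
flat and covariant derivatives agree and parallelism applies to the former. -/
lemma IsTubeBase.exists_diffAt_eq (hε : ε = -1 ∨ ε = 0 ∨ ε = 1) (h : IsTubeBase I ε g ξ)
    (i : Fin k) (x : M) (X : TangentSpace I x) :
    ∃ Y : TangentSpace I x, diffAt I (ξ i) x X = diffAt I g x Y := by
  obtain ⟨Y, hY⟩ := (h.parallel i).parallel x trivial X
  refine ⟨Y, ?_⟩
  have h1 := hY.1
  rw [add_zero, covDerivAlong, QProdProj, conormal_diffAt (h.immersion.mdifferentiableAt x)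
    (h.mdifferentiableAt_normal i x) (.of_forall fun y => ((h.parallel i).normal y trivial).1) X,
    QProdConormal_of_tangent hε (h.immersion.mem x) (h.tangent x X), h.orthogonal,
    h.ξ_slice] at h1
  simpa using h1

/-- For each coefficient vector `a`, the tangential part of `f_*` is `g_*` composed with some
endomorphism of the tangent space. -/
lemma IsTubeBase.exists_frame_diffAt_eq (hε : ε = -1 ∨ ε = 0 ∨ ε = 1) (h : IsTubeBase I ε g ξ)
    (a : AmbientSpace k) (x : M) (X : TangentSpace I x) :
    ∃ Y : TangentSpace I x,
      a.1 • diffAt I g x X + ∑ i, a.2.1 i • diffAt I (ξ i) x X = diffAt I g x Y := by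
  choose Y hY using fun i => h.exists_diffAt_eq hε i x X
  exact ⟨a.1 • X + ∑ i, a.2.1 i • Y i, by simp [map_sum, hY]⟩

lemma IsTubeBase.ambientForm_diffAt_frameMap (h : IsTubeBase I ε g ξ) {b : AmbientSpace k}
    (hε : ε = -1 ∨ ε = 0 ∨ ε = 1) (hb : (1 - ε ^ 2) * b.1 = 0) (x : M) (X : TangentSpace I x) :
    ambientForm ε (diffAt I g x X) (frameMap (g x) (fun i => ξ i x) b) = 0 := by
  have h1 : ε * ambientForm ε (diffAt I g x X) (g x) = 0 := by
    have := horPart_ambientForm_eq_zero hε (h.immersion.mem x) (h.tangent x X)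
    rwa [ambientForm_horPart_right, h.height_diffAt, zero_mul, sub_zero] at this
  rw [← ambientBilin_apply, frameMap]
  simp only [map_add, map_smul, map_sum, ambientBilin_apply, ambientForm_ddt_right, h.orthogonal,
    h.height_diffAt, smul_eq_mul, mul_zero, Finset.sum_const_zero, add_zero]
  -- Splits `1 = (1 - ε ^ 2) + ε ^ 2`: the first summand is killed by `hb`, the second by
  -- orthogonality to the position vector.
  linear_combination ambientForm ε (diffAt I g x X) (g x) * hb + ε * b.1 * h1

end TubeBase

/-! ### Openness of the set of regular points -/

section RegularPoints

variable {E H : Type*} [NormedAddCommGroup E] [NormedSpace ℝ E] [TopologicalSpace H]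
  {I : ModelWithCorners ℝ E H} {M : Type*} [TopologicalSpace M] [ChartedSpace H M]
  {F : Type*} [NormedAddCommGroup F] [NormedSpace ℝ F]

/-- The differential of `f` at `e⁻¹(y)` and the derivative at `y` of `f` in the chart `e` at `x`
differ by an isomorphism that does not depend on `f`. -/
lemma exists_fderiv_extChartAt_symm_eq [I.Boundaryless] [IsManifold I 1 M] (x : M) {y : E}
    (hy : y ∈ (extChartAt I x).target) :
    ∃ L : E ≃L[ℝ] TangentSpace I ((extChartAt I x).symm y), ∀ f : M → F,
      MDifferentiableAt I 𝓘(ℝ, F) f ((extChartAt I x).symm y) →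
      DifferentiableAt ℝ (f ∘ (extChartAt I x).symm) y ∧
      ∀ v, fderiv ℝ (f ∘ (extChartAt I x).symm) y v =
        mfderiv I 𝓘(ℝ, F) f ((extChartAt I x).symm y) (L v) := by
  have h1 := isInvertible_mfderivWithin_extChartAt_symm hy
  have h2 := mdifferentiableWithinAt_extChartAt_symm hy
  rw [I.range_eq_univ] at h1 h2
  rw [mfderivWithin_univ] at h1
  rw [mdifferentiableWithinAt_univ] at h2
  obtain ⟨L, hL⟩ := h1
  refine ⟨L, fun f hf => ?_⟩
  have h3 := hf.hasMFDerivAt.comp y h2.hasMFDerivAt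
  refine ⟨h3.hasFDerivAt.differentiableAt, fun v => ?_⟩
  rw [← mfderiv_eq_fderiv, h3.mfderiv]
  have h4 : mfderiv 𝓘(ℝ, E) I (extChartAt I x).symm y v = L v := DFunLike.congr_fun hL.symm v
  exact congrArg _ h4

/-- Injective linear maps form an open set in finite dimension, and in a chart the derivative
depends continuously on the point; the chart isomorphism transfers injectivity. -/
lemma isOpen_setOf_mfderiv_injective [FiniteDimensional ℝ E] [I.Boundaryless] [IsManifold I 1 M]
    {f : M → F} {U : Set M} (hU : IsOpen U) (hf : ContMDiffOn I 𝓘(ℝ, F) 1 f U) :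
    IsOpen {x | x ∈ U ∧ Function.Injective (mfderiv I 𝓘(ℝ, F) f x)} := by
  rw [isOpen_iff_mem_nhds]
  rintro x ⟨hxU, hx⟩
  set φ := extChartAt I x with hφ
  have hW : IsOpen (φ.target ∩ φ.symm ⁻¹' U) :=
    (continuousOn_extChartAt_symm x).isOpen_inter_preimage (isOpen_extChartAt_target x) hU
  have hmd : ∀ y ∈ U, MDifferentiableAt I 𝓘(ℝ, F) f y := fun y hy =>
    (hf.contMDiffAt (hU.mem_nhds hy)).mdifferentiableAt (by simp)
  have hsm : ContDiffOn ℝ 1 (f ∘ φ.symm) (φ.target ∩ φ.symm ⁻¹' U) := by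
    rw [← contMDiffOn_iff_contDiffOn]
    exact hf.comp ((contMDiffOn_extChartAt_symm x).mono Set.inter_subset_left)
      Set.inter_subset_right
  have hc : ContinuousOn (fderiv ℝ (f ∘ φ.symm)) (φ.target ∩ φ.symm ⁻¹' U) :=
    hsm.continuousOn_fderiv_of_isOpen hW (by simp)
  have hinj : ∀ y ∈ φ.target ∩ φ.symm ⁻¹' U, (Function.Injective (fderiv ℝ (f ∘ φ.symm) y) ↔
      Function.Injective (mfderiv I 𝓘(ℝ, F) f (φ.symm y))) := by
    rintro y ⟨hy, hyU⟩
    obtain ⟨L, hL⟩ := exists_fderiv_extChartAt_symm_eq (F := F) (I := I) x hy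
    have : ⇑(fderiv ℝ (f ∘ φ.symm) y) = mfderiv I 𝓘(ℝ, F) f (φ.symm y) ∘ L :=
      funext (hL f (hmd _ hyU)).2
    rw [this]
    exact L.toEquiv.injective_comp (mfderiv I 𝓘(ℝ, F) f (φ.symm y))
  have hV := hc.isOpen_inter_preimage hW ContinuousLinearMap.isOpen_injective
  have hxs : x ∈ φ.source := mem_extChartAt_source x
  have hxφ : φ.symm (φ x) = x := φ.left_inv hxs
  have hxW : φ x ∈ φ.target ∩ φ.symm ⁻¹' U := ⟨φ.map_source hxs, by simpa [hxφ] using hxU⟩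
  have hxV := hV.mem_nhds ⟨hxW, (hinj _ hxW).2 (by rw [hxφ]; exact hx)⟩
  filter_upwards [(continuousAt_extChartAt x).preimage_mem_nhds hxV,
    extChartAt_source_mem_nhds (I := I) x] with z hz hzs
  have hzφ : φ.symm (φ z) = z := φ.left_inv hzs
  have h1 := hz.1.2
  have h2 := (hinj _ hz.1).1 hz.2
  rw [Set.mem_preimage, hzφ] at h1
  rw [hzφ] at h2
  exact ⟨h1, h2⟩

end RegularPoints

lemma QProdProj_add_smul_horPart {n : ℕ} {ε : ℝ} {p v : AmbientSpace n} (hp : p ∈ QProd ε n)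
    (hv : v ∈ QProdTangent ε p) (c : ℝ) : QProdProj ε p (v + c • horPart p) = v := by
  have h1 : QProdConormal ε p (v + c • horPart p) = c := by
    have h2 : QProdConormal ε p v = 0 := hv
    rw [← conormalForm_apply, map_add, map_smul, conormalForm_apply, conormalForm_apply, h2,
      QProdConormal_horPart_right, QProdConormal_self hp]
    simp
  rw [QProdProj, h1, add_sub_cancel_right]

lemma QProdProj_of_tangent {n : ℕ} {ε : ℝ} {p v : AmbientSpace n}
    (hv : v ∈ QProdTangent ε p) : QProdProj ε p v = v := by
  have h2 : QProdConormal ε p v = 0 := hv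
  rw [QProdProj, h2, zero_smul, sub_zero]

/-! ### The normal part of `∂/∂t` along a curve -/

section TubeCurve

variable {k : ℕ} {ε : ℝ} {α : ℝ → AmbientSpace k} {J : Set ℝ}

lemma IsTubeCurve.differentiableAt (h : IsTubeCurve ε α J) {s : ℝ} (hs : s ∈ J) :
    DifferentiableAt ℝ α s :=
  (h.smooth.differentiableOn (by simp)).differentiableAt (h.isOpen.mem_nhds hs)

lemma IsTubeCurve.contDiffOn_deriv (h : IsTubeCurve ε α J) : ContDiffOn ℝ ∞ (deriv α) J :=
  ((contDiffOn_infty_iff_deriv_of_isOpen h.isOpen).1 h.smooth).2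

lemma IsTubeCurve.deriv_tangent (h : IsTubeCurve ε α J) {s : ℝ} (hs : s ∈ J) :
    deriv α s ∈ QProdTangent ε (α s) := by
  have := diffAt_mem_tangent (I := 𝓘(ℝ, ℝ)) (h.differentiableAt hs).mdifferentiableAt
    (Filter.mem_of_superset (h.isOpen.mem_nhds hs) h.mem) (1 : ℝ)
  rw [diffAt, mfderiv_eq_fderiv] at this
  exact this

lemma IsTubeCurve.deriv_height (h : IsTubeCurve ε α J) {s : ℝ} (hs : s ∈ J) :
    (deriv α s).2.2 ≠ 0 := by
  have h1 := (heightL k).hasFDerivAt.comp_hasDerivAt s (h.differentiableAt hs).hasDerivAt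
  have h2 := h.height s hs
  have h3 : deriv (fun s => (α s).2.2) s = (deriv α s).2.2 := h1.deriv
  rwa [h3] at h2

lemma IsTubeCurve.speed_pos (hε : ε = -1 ∨ ε = 0 ∨ ε = 1) (h : IsTubeCurve ε α J) {s : ℝ}
    (hs : s ∈ J) : 0 < ambientForm ε (deriv α s) (deriv α s) := by
  refine ambientForm_self_pos hε (h.mem s hs) (h.deriv_tangent hs) fun h0 => ?_
  exact h.deriv_height hs (by rw [h0]; rfl)

/-- The height component of the velocity of `α`, divided by its squared length. -/
def heightRatio (ε : ℝ) (α : ℝ → AmbientSpace k) (s : ℝ) : ℝ :=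
  (deriv α s).2.2 / ambientForm ε (deriv α s) (deriv α s)

lemma IsTubeCurve.contDiffOn_heightRatio (hε : ε = -1 ∨ ε = 0 ∨ ε = 1) (h : IsTubeCurve ε α J) :
    ContDiffOn ℝ ∞ (heightRatio ε α) J := by
  have h1 : ContDiffOn ℝ ∞ (fun s => ambientForm ε (deriv α s) (deriv α s)) J := by
    simp only [← ambientBilin_apply]
    exact ((ambientBilin k ε).contDiff.comp_contDiffOn h.contDiffOn_deriv).clm_apply
      h.contDiffOn_deriv
  exact ((heightL k).contDiff.comp_contDiffOn h.contDiffOn_deriv).div h1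
    fun s hs => (h.speed_pos hε hs).ne'

/-- The part of `∂/∂t` orthogonal to the velocity of `α`. -/
def normalCoeff (ε : ℝ) (α : ℝ → AmbientSpace k) (s : ℝ) : AmbientSpace k :=
  ddt k - heightRatio ε α s • deriv α s

lemma IsTubeCurve.contDiffOn_normalCoeff (hε : ε = -1 ∨ ε = 0 ∨ ε = 1) (h : IsTubeCurve ε α J) :
    ContDiffOn ℝ ∞ (normalCoeff ε α) J :=
  contDiffOn_const.sub ((h.contDiffOn_heightRatio hε).smul h.contDiffOn_deriv)

lemma IsTubeCurve.normalCoeff_tangent (h : IsTubeCurve ε α J) {s : ℝ} (hs : s ∈ J) :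
    normalCoeff ε α s ∈ QProdTangent ε (α s) := by
  have h1 : QProdConormal ε (α s) (deriv α s) = 0 := h.deriv_tangent hs
  change QProdConormal ε (α s) _ = 0
  rw [← conormalForm_apply, normalCoeff, map_sub, map_smul, conormalForm_apply,
    conormalForm_apply, h1, QProdConormal_ddt_right]
  simp

lemma IsTubeCurve.ambientForm_normalCoeff (hε : ε = -1 ∨ ε = 0 ∨ ε = 1) (h : IsTubeCurve ε α J)
    {s : ℝ} (hs : s ∈ J) : ambientForm ε (deriv α s) (normalCoeff ε α s) = 0 := by
  have h1 := h.speed_pos hε hs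
  rw [← ambientBilin_apply, normalCoeff, map_sub, map_smul, ambientBilin_apply,
    ambientBilin_apply, ambientForm_ddt_right, heightRatio, smul_eq_mul,
    div_mul_cancel₀ _ h1.ne', sub_self]

/-- The geodesic equation turns `α''` into a multiple of `horPart (α s)`. The derivative of
`heightRatio` is absorbed in `a`, so its constancy need not be known. -/
lemma IsTubeCurve.deriv_normalCoeff (hε : ε = -1 ∨ ε = 0 ∨ ε = 1) (h : IsTubeCurve ε α J)
    (hgeo : IsGeodesicOn ε α J) {s : ℝ} (hs : s ∈ J) :
    ∃ a b : ℝ, deriv (normalCoeff ε α) s = a • deriv α s + b • horPart (α s) := by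
  have h1 := ((h.contDiffOn_heightRatio hε).differentiableOn (by simp)).differentiableAt
    (h.isOpen.mem_nhds hs)
  have h2 := (h.contDiffOn_deriv.differentiableOn (by simp)).differentiableAt
    (h.isOpen.mem_nhds hs)
  have h3 := (h1.hasDerivAt.smul h2.hasDerivAt).const_sub (ddt k)
  have h4 : deriv (deriv α) s = QProdConormal ε (α s) (deriv (deriv α) s) • horPart (α s) :=
    sub_eq_zero.1 (hgeo s hs)
  have h5 : deriv (normalCoeff ε α) s = _ := h3.deriv
  refine ⟨-deriv (heightRatio ε α) s,
    -(heightRatio ε α s * QProdConormal ε (α s) (deriv (deriv α) s)), ?_⟩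
  rw [h5]
  conv_lhs => rw [h4]
  rw [smul_smul]
  module

end TubeCurve

/-! ### The direct statement -/

section Tube

variable {E H : Type*} [NormedAddCommGroup E] [NormedSpace ℝ E] [TopologicalSpace H]
  {I : ModelWithCorners ℝ E H} {N : Type*} [TopologicalSpace N] [ChartedSpace H N] {n k : ℕ}
  {ε : ℝ} {g : N → AmbientSpace n} {ξ : Fin k → N → AmbientSpace n} {α : ℝ → AmbientSpace k}
  {J : Set ℝ}

lemma tubeMap_mem_QProd (hε : ε = -1 ∨ ε = 0 ∨ ε = 1) (hb : IsTubeBase I ε g ξ)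
    (hα : IsTubeCurve ε α J) : Set.MapsTo (tubeMap g ξ α) (Set.univ ×ˢ J) (QProd ε n) :=
  fun q hq => (hb.isAdaptedFrame q.1).mem_QProd hε (hα.mem q.2 hq.2)

lemma exists_diffAt_tubeMap_eq (hε : ε = -1 ∨ ε = 0 ∨ ε = 1) (hb : IsTubeBase I ε g ξ)
    {x : N} {s : ℝ} (hα : DifferentiableAt ℝ α s) (X : TangentSpace (I.prod 𝓘(ℝ, ℝ)) (x, s)) :
    ∃ Y : TangentSpace I x, diffAt (I.prod 𝓘(ℝ, ℝ)) (tubeMap g ξ α) (x, s) X =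
      diffAt I g x Y + X.2 • frameMap (g x) (fun i => ξ i x) (deriv α s) := by
  obtain ⟨Y, hY⟩ := hb.exists_frame_diffAt_eq hε (α s) x X.1
  refine ⟨Y, ?_⟩
  rw [(hasMFDerivAt_tubeMap (hb.immersion.mdifferentiableAt x)
    (fun i => hb.mdifferentiableAt_normal i x) hα).2, hY]

variable (I) in
/-- The tangent vector `c ∂/∂s` of `N × ℝ`. -/
def verticalVector (q : N × ℝ) (c : ℝ) : TangentSpace (I.prod 𝓘(ℝ, ℝ)) q := ((0, c) : E × ℝ)

lemma diffAt_tubeMap_verticalVector (hb : IsTubeBase I ε g ξ) {q : N × ℝ}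
    (hα : DifferentiableAt ℝ α q.2) (c : ℝ) :
    diffAt (I.prod 𝓘(ℝ, ℝ)) (tubeMap g ξ α) q (verticalVector I q c) =
      c • frameMap (g q.1) (fun i => ξ i q.1) (deriv α q.2) := by
  have h := (hasMFDerivAt_tubeMap (hb.immersion.mdifferentiableAt q.1)
    (fun i => hb.mdifferentiableAt_normal i q.1) hα).2 (verticalVector I q c)
  have h1 : ∀ V : N → AmbientSpace n,
      diffAt I V q.1 (verticalVector I q c).1 = 0 := fun V => map_zero _
  rw [h1] at h
  simp only [h1, smul_zero, Finset.sum_const_zero, zero_add] at h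
  exact h

/-- At a regular point, every vector of `g_* T_xN` is of the form `f_* (Z, 0)`. -/
lemma exists_diffAt_tubeMap_eq_diffAt [FiniteDimensional ℝ E] (hε : ε = -1 ∨ ε = 0 ∨ ε = 1)
    (hb : IsTubeBase I ε g ξ) {x : N} {s : ℝ} (hα : DifferentiableAt ℝ α s)
    (hinj : Function.Injective (diffAt (I.prod 𝓘(ℝ, ℝ)) (tubeMap g ξ α) (x, s)))
    (Y : TangentSpace I x) :
    ∃ Z : TangentSpace (I.prod 𝓘(ℝ, ℝ)) (x, s), Z.2 = 0 ∧
      diffAt (I.prod 𝓘(ℝ, ℝ)) (tubeMap g ξ α) (x, s) Z = diffAt I g x Y := by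
  let D : E × ℝ →ₗ[ℝ] AmbientSpace n :=
    (diffAt (I.prod 𝓘(ℝ, ℝ)) (tubeMap g ξ α) (x, s)).toLinearMap
  let P : E →ₗ[ℝ] AmbientSpace n := D ∘ₗ LinearMap.inl ℝ E ℝ
  let Q : E →ₗ[ℝ] AmbientSpace n := (diffAt I g x).toLinearMap
  have hP : Function.Injective P := fun a b hab => by
    have := hinj hab
    exact LinearMap.inl_injective this
  have hQ : Function.Injective Q := hb.immersion.injective x
  have hle : LinearMap.range P ≤ LinearMap.range Q := by
    rintro _ ⟨X, rfl⟩
    obtain ⟨Y, hY⟩ := exists_diffAt_tubeMap_eq hε hb hα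
      ((X, (0 : ℝ)) : TangentSpace (I.prod 𝓘(ℝ, ℝ)) (x, s))
    refine ⟨Y, ?_⟩
    refine Eq.trans ?_ hY.symm
    exact (add_eq_left.2 (zero_smul ℝ _)).symm
  -- Both ranges have the dimension of `E`, one by regularity and the other because `g` is an
  -- immersion, so the inclusion is an equality.
  have heq := Submodule.eq_of_le_of_finrank_le hle
    (by rw [LinearMap.finrank_range_of_inj hP, LinearMap.finrank_range_of_inj hQ])
  have hY : Q Y ∈ LinearMap.range P := heq ▸ ⟨Y, rfl⟩
  obtain ⟨Z, hZ⟩ := hY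
  exact ⟨(Z, (0 : ℝ)), rfl, hZ⟩

theorem isParallelNormalOn_tubeMap [FiniteDimensional ℝ E] (hε : ε = -1 ∨ ε = 0 ∨ ε = 1)
    (hb : IsTubeBase I ε g ξ) (hα : IsTubeCurve ε α J) (hgeo : IsGeodesicOn ε α J) :
    (∀ q ∈ regularPoints I (tubeMap g ξ α) J,
      IsSplittingAt (I.prod 𝓘(ℝ, ℝ)) ε (tubeMap g ξ α) q (ddt n)
        (verticalVector I q (heightRatio ε α q.2)) (tubeMap g ξ (normalCoeff ε α) q)) ∧
    IsParallelNormalOn (I.prod 𝓘(ℝ, ℝ)) ε (tubeMap g ξ α)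
      (regularPoints I (tubeMap g ξ α) J) (tubeMap g ξ (normalCoeff ε α)) := by
  have hnor : ∀ q ∈ regularPoints I (tubeMap g ξ α) J, tubeMap g ξ (normalCoeff ε α) q ∈
      normalSpaceAt (I.prod 𝓘(ℝ, ℝ)) ε (tubeMap g ξ α) q := by
    rintro ⟨x, s⟩ ⟨hs, -⟩
    have hs : s ∈ J := hs
    have hfr := hb.isAdaptedFrame x
    refine ⟨(hfr.conormal hε _ _).trans (hα.normalCoeff_tangent hs), fun X => ?_⟩
    obtain ⟨Y, hY⟩ := exists_diffAt_tubeMap_eq hε hb (hα.differentiableAt hs) X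
    rw [hY, ← ambientBilin_apply, map_add, map_smul, add_apply, smul_apply, ambientBilin_apply,
      ambientBilin_apply, tubeMap_eq_frameMap,
      hb.ambientForm_diffAt_frameMap hε
        (fst_eq_zero_of_tangent hε (hα.mem s hs) (hα.normalCoeff_tangent hs)),
      hfr.ambientForm_eq hε (hα.mem s hs) (hα.deriv_tangent hs) (hα.normalCoeff_tangent hs),
      hα.ambientForm_normalCoeff hε hs]
    simp
  refine ⟨fun q hq => ⟨?_, hnor q hq⟩, ?_, hnor, ?_⟩
  · rw [diffAt_tubeMap_verticalVector hb (hα.differentiableAt hq.1), tubeMap_eq_frameMap,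
      normalCoeff, frameMap_sub, frameMap_smul, frameMap_ddt]
    simp
  · refine (contMDiffOn_tubeMap hb.immersion.smooth
      (fun i => contMDiffOn_univ.1 (hb.parallel i).smooth)
      (hα.contDiffOn_normalCoeff hε)).mono fun q hq => ⟨trivial, hq.1⟩
  · rintro ⟨x, s⟩ ⟨hs, hinj⟩ X
    have hs : s ∈ J := hs
    have hfr := hb.isAdaptedFrame x
    have hdβ := ((hα.contDiffOn_normalCoeff hε).differentiableOn (by simp)).differentiableAt
      (hα.isOpen.mem_nhds hs)
    obtain ⟨Y, hY⟩ := exists_diffAt_tubeMap_eq hε hb hdβ X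
    obtain ⟨Z, -, hZ⟩ := exists_diffAt_tubeMap_eq_diffAt hε hb (hα.differentiableAt hs) hinj Y
    obtain ⟨a, b, hab⟩ := hα.deriv_normalCoeff hε hgeo hs
    have hfm := hasMFDerivAt_tubeMap (hb.immersion.mdifferentiableAt x)
      (fun i => hb.mdifferentiableAt_normal i x) (hα.differentiableAt hs)
    -- `Z` realises the `g_*` part of the derivative of `η`, and the vertical vector realises its
    -- component along the frame image of `α'`; only a multiple of `horPart f` is left over.
    let W := Z + verticalVector I (x, s) (X.2 * a)
    have hW : diffAt (I.prod 𝓘(ℝ, ℝ)) (tubeMap g ξ α) (x, s) W =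
        diffAt I g x Y + (X.2 * a) • frameMap (g x) (fun i => ξ i x) (deriv α s) := by
      rw [← hZ, map_add, diffAt_tubeMap_verticalVector hb (hα.differentiableAt hs)]
    have hWt := diffAt_mem_tangent (ε := ε) hfm.1 (Filter.mem_of_superset
      ((isOpen_univ.prod hα.isOpen).mem_nhds ⟨trivial, hs⟩) (tubeMap_mem_QProd hε hb hα)) W
    refine ⟨W, ?_, ?_, fun _ => ?_⟩
    · rw [add_zero, covDerivAlong, hY, hab, frameMap_add, frameMap_smul, frameMap_smul,
        frameMap_horPart hfr.height hfr.heights, smul_add, smul_smul, smul_smul, ← add_assoc, ← hW]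
      exact QProdProj_add_smul_horPart (tubeMap_mem_QProd hε hb hα ⟨trivial, hs⟩) hWt _
    · simp [QProdTangent, QProdConormal]
    · simp [ambientForm]

lemma isOpen_regularPoints [FiniteDimensional ℝ E] [I.Boundaryless] [IsManifold I ∞ N]
    (hb : IsTubeBase I ε g ξ) (hα : IsTubeCurve ε α J) :
    IsOpen (regularPoints I (tubeMap g ξ α) J) := by
  have : IsManifold I 1 N := IsManifold.of_le (n := ∞) (by simp)
  have := isOpen_setOf_mfderiv_injective (isOpen_univ.prod hα.isOpen)
    ((contMDiffOn_tubeMap hb.immersion.smooth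
      (fun i => contMDiffOn_univ.1 (hb.parallel i).smooth) hα.smooth).of_le (by simp))
  convert this using 1
  ext q
  simp only [regularPoints, Set.mem_prod, Set.mem_univ, true_and]
  rfl

end Tube

/-! ### The converse in a chart: structure equations for `f` and `η` -/

section Chart

variable {E : Type*} [NormedAddCommGroup E] [NormedSpace ℝ E] {n : ℕ} {ε : ℝ}

/-- The hypotheses on `f` and on the normal part `η` of `∂/∂t`, on an open subset of a vector
space. -/
structure IsParallelChart (ε : ℝ) (f η : E → AmbientSpace n) (U : Set E) : Prop where
  isOpen : IsOpen U
  smooth : ContDiffOn ℝ ∞ f U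
  smooth_normal : ContDiffOn ℝ ∞ η U
  mem : ∀ y ∈ U, f y ∈ QProd ε n
  injective : ∀ y ∈ U, Function.Injective (fderiv ℝ f y)
  tangent : ∀ y ∈ U, η y ∈ QProdTangent ε (f y)
  orthogonal : ∀ y ∈ U, ∀ X, ambientForm ε (fderiv ℝ f y X) (η y) = 0
  splitting : ∀ y ∈ U, ∃ T : E, T ≠ 0 ∧ fderiv ℝ f y T = ddt n - η y
  parallel : ∀ y ∈ U, ∀ X, ∃ Y, QProdProj ε (f y) (fderiv ℝ η y X) = fderiv ℝ f y Y

lemma diffAt_eq_fderiv (f : E → AmbientSpace n) (y : E) :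
    diffAt 𝓘(ℝ, E) f y = fderiv ℝ f y := mfderiv_eq_fderiv

namespace IsParallelChart

variable {f η : E → AmbientSpace n} {U : Set E} {y : E}

lemma mono (h : IsParallelChart ε f η U) {V : Set E} (hV : IsOpen V) (hVU : V ⊆ U) :
    IsParallelChart ε f η V where
  isOpen := hV
  smooth := h.smooth.mono hVU
  smooth_normal := h.smooth_normal.mono hVU
  mem y hy := h.mem y (hVU hy)
  injective y hy := h.injective y (hVU hy)
  tangent y hy := h.tangent y (hVU hy)
  orthogonal y hy := h.orthogonal y (hVU hy)
  splitting y hy := h.splitting y (hVU hy)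
  parallel y hy := h.parallel y (hVU hy)

lemma differentiableAt (h : IsParallelChart ε f η U) (hy : y ∈ U) : DifferentiableAt ℝ f y :=
  (h.smooth.differentiableOn (by simp)).differentiableAt (h.isOpen.mem_nhds hy)

lemma differentiableAt_normal (h : IsParallelChart ε f η U) (hy : y ∈ U) :
    DifferentiableAt ℝ η y :=
  (h.smooth_normal.differentiableOn (by simp)).differentiableAt (h.isOpen.mem_nhds hy)

lemma fderiv_tangent (h : IsParallelChart ε f η U) (hy : y ∈ U) (X : E) :
    fderiv ℝ f y X ∈ QProdTangent ε (f y) := by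
  rw [← diffAt_eq_fderiv]
  exact diffAt_mem_tangent (h.differentiableAt hy).mdifferentiableAt
    (Filter.mem_of_superset (h.isOpen.mem_nhds hy) h.mem) X

/-- A Weingarten formula for the flat derivative: parallelism leaves a tangent term, and
`conormal_diffAt` evaluates the position term, where `⟨f_* X, η⟩ = 0` leaves only the product of
heights. -/
lemma exists_fderiv_normal_eq (hε : ε = -1 ∨ ε = 0 ∨ ε = 1) (h : IsParallelChart ε f η U)
    (hy : y ∈ U) (X : E) :
    ∃ Y, fderiv ℝ η y X = fderiv ℝ f y Y +
      (ε * (fderiv ℝ f y X).2.2 * (η y).2.2) • horPart (f y) := by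
  obtain ⟨Y, hY⟩ := h.parallel y hy X
  refine ⟨Y, ?_⟩
  have h1 : QProdConormal ε (f y) (fderiv ℝ η y X) =
      -QProdConormal ε (fderiv ℝ f y X) (η y) := by
    have := conormal_diffAt (h.differentiableAt hy).mdifferentiableAt
      (h.differentiableAt_normal hy).mdifferentiableAt
      (Filter.mem_of_superset (h.isOpen.mem_nhds hy) h.tangent) X
    rw [diffAt_eq_fderiv, diffAt_eq_fderiv] at this
    exact this
  rw [QProdConormal_of_tangent hε (h.mem y hy) (h.fderiv_tangent hy X), h.orthogonal y hy] at h1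
  have h2 : QProdConormal ε (f y) (fderiv ℝ η y X) =
      ε * (fderiv ℝ f y X).2.2 * (η y).2.2 := by rw [h1]; ring
  rw [QProdProj, h2] at hY
  rw [← hY, sub_add_cancel]

/-- Pair `∂/∂t = f_* T + η` with `η`. -/
lemma ambientForm_normal_self (h : IsParallelChart ε f η U) (hy : y ∈ U) :
    ambientForm ε (η y) (η y) = (η y).2.2 := by
  obtain ⟨T, -, hT⟩ := h.splitting y hy
  have h1 := h.orthogonal y hy T
  rw [hT, ← ambientBilin_apply, map_sub, sub_apply, ambientBilin_apply, ambientBilin_apply,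
    ambientForm_ddt_left] at h1
  linarith

lemma ambientForm_fderiv_normal (hε : ε = -1 ∨ ε = 0 ∨ ε = 1) (h : IsParallelChart ε f η U)
    (hy : y ∈ U) (X : E) : ambientForm ε (fderiv ℝ η y X) (η y) = 0 := by
  obtain ⟨Y, hY⟩ := h.exists_fderiv_normal_eq hε hy X
  have h2 := horPart_ambientForm_eq_zero hε (h.mem y hy) (h.tangent y hy)
  rw [hY, ← ambientBilin_apply, map_add, map_smul, add_apply, smul_apply, ambientBilin_apply,
    ambientBilin_apply, h.orthogonal y hy, ambientForm_comm (horPart _), smul_eq_mul]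
  linear_combination (fderiv ℝ f y X).2.2 * (η y).2.2 * h2

/-- Differentiating `⟨η, η⟩ = ⟨η, ∂/∂t⟩` gives `2 ⟨Dη, η⟩` on the left, and this vanishes by
parallelism. -/
lemma fderiv_normal_height (hε : ε = -1 ∨ ε = 0 ∨ ε = 1) (h : IsParallelChart ε f η U)
    (hy : y ∈ U) (X : E) : (fderiv ℝ η y X).2.2 = 0 := by
  have hd := (h.differentiableAt_normal hy).hasFDerivAt
  have h1 := (ambientBilin n ε).hasFDerivAt_of_bilinear hd hd
  have h2 := (heightL n).hasFDerivAt.comp y hd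
  have h3 : (fun z => ambientBilin n ε (η z) (η z)) =ᶠ[𝓝 y] heightL n ∘ η :=
    Filter.mem_of_superset (h.isOpen.mem_nhds hy) fun z hz =>
      (ambientBilin_apply _ _).trans (h.ambientForm_normal_self hz)
  have h4 := DFunLike.congr_fun (h1.unique (h2.congr_of_eventuallyEq h3)) X
  have h5 : ambientBilin n ε (η y) (fderiv ℝ η y X) + ambientBilin n ε (fderiv ℝ η y X) (η y) =
    (fderiv ℝ η y X).2.2 := h4
  rw [ambientBilin_apply, ambientBilin_apply, ambientForm_comm (η y),
    h.ambientForm_fderiv_normal hε hy] at h5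
  linarith

/-- Self-adjointness of the shape operator of `η`: differentiate `⟨η, f_* Z⟩ = 0` for constant `Z`
and use the symmetry of the second derivative of `f`. -/
lemma ambientForm_fderiv_symm (h : IsParallelChart ε f η U) (hy : y ∈ U) (X Z : E) :
    ambientForm ε (fderiv ℝ η y X) (fderiv ℝ f y Z) =
      ambientForm ε (fderiv ℝ η y Z) (fderiv ℝ f y X) := by
  have hf : ContDiffAt ℝ ∞ f y := h.smooth.contDiffAt (h.isOpen.mem_nhds hy)
  have hsym : IsSymmSndFDerivAt ℝ f y := hf.isSymmSndFDerivAt (by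
    rw [minSmoothness_of_isRCLikeNormedField]; exact WithTop.coe_le_coe.2 le_top)
  have hd2 : DifferentiableAt ℝ (fderiv ℝ f) y :=
    (hf.fderiv_right (m := 1) (by norm_cast)).differentiableAt (by simp)
  have key : ∀ X Z : E, ambientForm ε (η y) (fderiv ℝ (fderiv ℝ f) y X Z) +
      ambientForm ε (fderiv ℝ η y X) (fderiv ℝ f y Z) = 0 := by
    intro X Z
    have h1 : HasFDerivAt (fun z => fderiv ℝ f z Z) ((fderiv ℝ (fderiv ℝ f) y).flip Z) y :=
      hd2.hasFDerivAt.clm_apply (hasFDerivAt_const Z y) |>.congr_fderiv 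
        (by rw [ContinuousLinearMap.comp_zero, zero_add])
    have h2 := (ambientBilin n ε).hasFDerivAt_of_bilinear
      (h.differentiableAt_normal hy).hasFDerivAt h1
    have h3 : (fun z => ambientBilin n ε (η z) (fderiv ℝ f z Z)) =ᶠ[𝓝 y] fun _ => 0 :=
      Filter.mem_of_superset (h.isOpen.mem_nhds hy) fun z hz =>
        (ambientBilin_apply _ _).trans ((ambientForm_comm _ _).trans (h.orthogonal z hz Z))
    have h4 := DFunLike.congr_fun
      (h2.unique ((hasFDerivAt_const (0 : ℝ) y).congr_of_eventuallyEq h3)) X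
    have h5 : ambientBilin n ε (η y) (fderiv ℝ (fderiv ℝ f) y X Z) +
      ambientBilin n ε (fderiv ℝ η y X) (fderiv ℝ f y Z) = 0 := h4
    rwa [ambientBilin_apply, ambientBilin_apply] at h5
  have h1 := key X Z
  have h2 := key Z X
  rw [hsym.eq] at h1
  linarith

lemma height_lt_one (hε : ε = -1 ∨ ε = 0 ∨ ε = 1) (h : IsParallelChart ε f η U) (hy : y ∈ U) :
    0 ≤ (η y).2.2 ∧ (η y).2.2 < 1 := by
  refine ⟨h.ambientForm_normal_self hy ▸
    (ambientForm_self_nonneg hε (h.mem y hy) (h.tangent y hy)).1, ?_⟩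
  obtain ⟨T, hT0, hT⟩ := h.splitting y hy
  have hne : fderiv ℝ f y T ≠ 0 := fun h0 =>
    hT0 (h.injective y hy (h0.trans (map_zero _).symm))
  have h1 := ambientForm_self_pos hε (h.mem y hy) (h.fderiv_tangent hy T) hne
  have h2 : ambientForm ε (fderiv ℝ f y T) (fderiv ℝ f y T) = 1 - (η y).2.2 := by
    conv_lhs => rw [← ambientBilin_apply]; arg 2; rw [hT]
    rw [map_sub, ambientBilin_apply, ambientBilin_apply, h.orthogonal y hy,
      ambientForm_ddt_right, hT]
    simp [ddt]
  linarith

/-- By symmetry, pairing the derivative along `T` with `f_* Y` amounts to pairing `Dη(Y)` with `∂/∂t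
- η`, which gives `0`. With `Y` the tangential part itself, definiteness of the metric kills that
part. -/
lemma fderiv_normal_of_splitting (hε : ε = -1 ∨ ε = 0 ∨ ε = 1) (h : IsParallelChart ε f η U)
    (hy : y ∈ U) {T : E} (hT : fderiv ℝ f y T = ddt n - η y) :
    fderiv ℝ η y T = (ε * (1 - (η y).2.2) * (η y).2.2) • horPart (f y) := by
  obtain ⟨Y, hY⟩ := h.exists_fderiv_normal_eq hε hy T
  have hTh : (fderiv ℝ f y T).2.2 = 1 - (η y).2.2 := by rw [hT]; simp [ddt]
  rw [hTh] at hY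
  have h1 : ambientForm ε (fderiv ℝ η y T) (fderiv ℝ f y Y) = 0 := by
    rw [h.ambientForm_fderiv_symm hy, hT, ← ambientBilin_apply, map_sub, ambientBilin_apply,
      ambientBilin_apply, ambientForm_ddt_right, h.fderiv_normal_height hε hy,
      h.ambientForm_fderiv_normal hε hy, sub_zero]
  have h2 := horPart_ambientForm_eq_zero hε (h.mem y hy) (h.fderiv_tangent hy Y)
  have h3 : ambientForm ε (fderiv ℝ f y Y) (fderiv ℝ f y Y) = 0 := by
    rw [hY, ← ambientBilin_apply, map_add, map_smul, add_apply, smul_apply, ambientBilin_apply,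
      ambientBilin_apply, ambientForm_comm (horPart _), smul_eq_mul] at h1
    linear_combination h1 - (1 - (η y).2.2) * (η y).2.2 * h2
  rw [hY, (ambientForm_self_nonneg hε (h.mem y hy) (h.fderiv_tangent hy Y)).2 h3, zero_add]

lemma height_eq_of_convex (hε : ε = -1 ∨ ε = 0 ∨ ε = 1) (h : IsParallelChart ε f η U)
    (hU : Convex ℝ U) {z : E} (hy : y ∈ U) (hz : z ∈ U) : (η y).2.2 = (η z).2.2 := by
  have hd : ∀ x ∈ U, HasFDerivAt (fun x => (η x).2.2) (0 : E →L[ℝ] ℝ) x := fun x hx =>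
    ((heightL n).hasFDerivAt.comp x (h.differentiableAt_normal hx).hasFDerivAt).congr_fderiv
      (by ext X; exact h.fderiv_normal_height hε hx X)
  refine hU.is_const_of_fderivWithin_eq_zero (𝕜 := ℝ)
    (fun x hx => (hd x hx).differentiableAt.differentiableWithinAt) (fun x hx => ?_) hy hz
  rw [fderivWithin_of_isOpen h.isOpen hx, (hd x hx).fderiv]

end IsParallelChart

end Chart

/-! ### Straightening a line field by given coordinates -/

section Straightening

variable {E : Type*} [NormedAddCommGroup E] [NormedSpace ℝ E] [FiniteDimensional ℝ E]
  {F : Type*} [NormedAddCommGroup F] [NormedSpace ℝ F] [FiniteDimensional ℝ F]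

/-- Coordinates `(P, h)` in which the first integrals of a line field `T` with `dP(T) = 0` and
`dh(T) ≠ 0` depend on `P` only. -/
lemma exists_straightening (hdim : Module.finrank ℝ E = Module.finrank ℝ F + 1)
    {V : Set E} (hV : IsOpen V) {x₀ : E} (hx₀ : x₀ ∈ V) {P : E → F} {h : E → ℝ}
    (hP : ContDiffOn ℝ ∞ P V) (hh : ContDiffOn ℝ ∞ h V)
    (hinj : ∀ X, fderiv ℝ P x₀ X = 0 → fderiv ℝ h x₀ X = 0 → X = 0)
    {T : E → E} (hPT : ∀ y ∈ V, fderiv ℝ P y (T y) = 0) (hhT : ∀ y ∈ V, fderiv ℝ h y (T y) ≠ 0) :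
    ∃ (Φ : OpenPartialHomeomorph (F × ℝ) E) (r : ℝ), 0 < r ∧
      Φ.source = Metric.ball (P x₀) r ×ˢ Metric.ball (h x₀) r ∧ x₀ ∈ Φ.target ∧ Φ.target ⊆ V ∧
      ContDiffOn ℝ ∞ Φ Φ.source ∧ ContDiffOn ℝ ∞ Φ.symm Φ.target ∧
      (∀ y ∈ Φ.target, Φ.symm y = (P y, h y)) ∧
      ∀ {W : Type} [NormedAddCommGroup W] [NormedSpace ℝ W] (K : E → W),
        DifferentiableOn ℝ K V → (∀ y ∈ V, fderiv ℝ K y (T y) = 0) →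
        ∀ u s s', (u, s) ∈ Φ.source → (u, s') ∈ Φ.source → K (Φ (u, s)) = K (Φ (u, s')) := by
  set Ψ : E → F × ℝ := fun y => (P y, h y) with hΨ
  have hΨs : ContDiffOn ℝ ∞ Ψ V := hP.prodMk hh
  have hdim' : Module.finrank ℝ E = Module.finrank ℝ (F × ℝ) := by simp [hdim]
  have hΨd : ∀ y ∈ V, ∀ X, fderiv ℝ Ψ y X = (fderiv ℝ P y X, fderiv ℝ h y X) := by
    intro y hy X
    have h1 := ((hP.differentiableOn (by simp)).differentiableAt (hV.mem_nhds hy))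
    have h2 := ((hh.differentiableOn (by simp)).differentiableAt (hV.mem_nhds hy))
    rw [hΨ, h1.fderiv_prodMk h2]; rfl
  set V' : Set E := V ∩ fderiv ℝ Ψ ⁻¹' {L | Function.Injective L} with hV'
  have hV'o : IsOpen V' := (hΨs.continuousOn_fderiv_of_isOpen hV (by simp)).isOpen_inter_preimage
    hV ContinuousLinearMap.isOpen_injective
  have hequiv : ∀ y ∈ V', ∃ L : E ≃L[ℝ] F × ℝ, (L : E →L[ℝ] F × ℝ) = fderiv ℝ Ψ y := by
    rintro y ⟨-, hy⟩
    refine ⟨(LinearEquiv.ofInjectiveOfFinrankEq (fderiv ℝ Ψ y).toLinearMap hy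
      hdim').toContinuousLinearEquiv, ?_⟩
    ext X <;> rfl
  have hx₀' : x₀ ∈ V' := by
    refine ⟨hx₀, ?_⟩
    refine (injective_iff_map_eq_zero (fderiv ℝ Ψ x₀)).2 fun X hX => ?_
    rw [hΨd x₀ hx₀, Prod.mk_eq_zero] at hX
    exact hinj X hX.1 hX.2
  obtain ⟨L₀, hL₀⟩ := hequiv x₀ hx₀'
  have hΨa : ∀ y ∈ V, ContDiffAt ℝ ∞ Ψ y := fun y hy => hΨs.contDiffAt (hV.mem_nhds hy)
  have hΨda : ∀ y ∈ V, HasFDerivAt Ψ (fderiv ℝ Ψ y) y := fun y hy =>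
    ((hΨa y hy).differentiableAt (by simp)).hasFDerivAt
  let e₀ := (hΨa x₀ hx₀).toOpenPartialHomeomorph Ψ (f' := L₀)
    (by rw [hL₀]; exact hΨda x₀ hx₀) (by simp)
  have he₀ : x₀ ∈ e₀.source := (hΨa x₀ hx₀).mem_toOpenPartialHomeomorph_source _ _
  let e := e₀.restrOpen V' hV'o
  have hes : e.source = e₀.source ∩ V' := rfl
  have hex : x₀ ∈ e.source := ⟨he₀, hx₀'⟩
  have heΨ : ⇑e = Ψ := rfl
  obtain ⟨r, hr, hball⟩ := Metric.isOpen_iff.1 e.open_target _ (e.map_source hex)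
  rw [← ball_prod_same] at hball
  -- On a box each fibre `{u} × J` is an interval, so a function with zero derivative along it is
  -- constant.
  let Φ := e.symm.restrOpen (Metric.ball (P x₀) r ×ˢ Metric.ball (h x₀) r)
    (Metric.isOpen_ball.prod Metric.isOpen_ball)
  have hΦs : Φ.source = Metric.ball (P x₀) r ×ˢ Metric.ball (h x₀) r :=
    Set.inter_eq_right.2 hball
  have hΦt : ∀ y ∈ Φ.target, y ∈ e.source := fun y hy => hy.1
  have hΦsymm : ⇑Φ.symm = Ψ := rfl
  have hΦe : ∀ q ∈ Φ.source, q ∈ e.target := fun q hq => hq.1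
  have hΦsm : ContDiffOn ℝ ∞ Φ Φ.source := by
    intro q hq
    have h1 := e.map_target (hΦe q hq)
    obtain ⟨L, hL⟩ := hequiv _ h1.2
    refine (e.contDiffAt_symm (f₀' := L) (hΦe q hq) ?_ (hΨa _ h1.2.1)).contDiffWithinAt
    rw [hL]; exact hΨda _ h1.2.1
  have hΦV : Φ.target ⊆ V := fun y hy => (hΦt y hy).2.1
  refine ⟨Φ, r, hr, hΦs, ?_, hΦV, hΦsm, hΨs.mono hΦV, fun y _ => rfl, ?_⟩
  · have h1 : Φ (Ψ x₀) ∈ Φ.target := Φ.map_source (hΦs ▸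
      ⟨Metric.mem_ball_self hr, Metric.mem_ball_self hr⟩)
    have h2 : Φ (Ψ x₀) = x₀ := e.left_inv hex
    rwa [h2] at h1
  · intro W _ _ K hK hKT u s s' hs hs'
    have hu : u ∈ Metric.ball (P x₀) r := (hΦs ▸ hs : (u, s) ∈ _ ×ˢ _).1
    have hsJ : s ∈ Metric.ball (h x₀) r := (hΦs ▸ hs : (u, s) ∈ _ ×ˢ _).2
    have hsJ' : s' ∈ Metric.ball (h x₀) r := (hΦs ▸ hs' : (u, s') ∈ _ ×ˢ _).2
    have hd : ∀ t ∈ Metric.ball (h x₀) r, HasDerivAt (fun t => K (Φ (u, t))) 0 t := by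
      intro t ht
      have hq : (u, t) ∈ Φ.source := hΦs ▸ ⟨hu, ht⟩
      have hy : Φ (u, t) ∈ V := hΦV (Φ.map_source hq)
      have hinj' := (hΦt _ (Φ.map_source hq)).2.2
      have h1 : HasFDerivAt Φ (fderiv ℝ Φ (u, t)) (u, t) :=
        ((hΦsm.differentiableOn (by simp)).differentiableAt
          (Φ.open_source.mem_nhds hq)).hasFDerivAt
      have h2 : HasDerivAt (fun t => (u, t)) ((0, 1) : F × ℝ) t :=
        (hasDerivAt_const t u).prodMk (hasDerivAt_id t)
      have h3 := h1.comp_hasDerivAt t h2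
      have h4 := ((hK.differentiableAt (hV.mem_nhds hy)).hasFDerivAt).comp_hasDerivAt t h3
      have h5 := (hΨda _ hy).comp_hasDerivAt t h3
      have h6 : Ψ ∘ (⇑Φ ∘ fun t => (u, t)) =ᶠ[𝓝 t] fun t => (u, t) :=
        Filter.mem_of_superset (Metric.isOpen_ball.mem_nhds ht) fun t' ht' =>
          Φ.left_inv (hΦs ▸ ⟨hu, ht'⟩)
      have h7 := h5.unique (h2.congr_of_eventuallyEq h6)
      set v := fderiv ℝ Φ (u, t) (0, 1)
      -- The coordinate vector `v` satisfies `dP(v) = 0` and `dh(v) = 1`; injectivity of `dΨ`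
      -- therefore gives `T = dh(T) • v`, so a first integral of `T` is annihilated by `v`.
      have h8 : fderiv ℝ Ψ (Φ (u, t)) (fderiv ℝ h (Φ (u, t)) (T (Φ (u, t))) • v) =
          fderiv ℝ Ψ (Φ (u, t)) (T (Φ (u, t))) := by
        rw [map_smul, h7, hΨd _ hy (T _), hPT _ hy]
        simp
      have h9 : fderiv ℝ K (Φ (u, t)) v = 0 := by
        have := congrArg (fderiv ℝ K (Φ (u, t))) (hinj' h8)
        rw [map_smul, hKT _ hy] at this
        exact (smul_eq_zero.1 this).resolve_left (hhT _ hy)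
      rwa [h9] at h4
    refine (convex_ball (h x₀) r).is_const_of_fderivWithin_eq_zero (𝕜 := ℝ)
      (f := fun t => K (Φ (u, t)))
      (fun t ht => (hd t ht).differentiableAt.differentiableWithinAt) (fun t ht => ?_) hsJ hsJ'
    rw [fderivWithin_of_isOpen Metric.isOpen_ball ht, (hd t ht).hasFDerivAt.fderiv]
    ext; simp

end Straightening

lemma mfderiv_opens_val_bijective {F : Type*} [NormedAddCommGroup F] [NormedSpace ℝ F]
    (N : TopologicalSpace.Opens F) (x : N) :
    Function.Bijective (mfderiv 𝓘(ℝ, F) 𝓘(ℝ, F) (Subtype.val : N → F) x) :=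
  (mdifferentiable_chart (I := 𝓘(ℝ, F)) x).mfderiv_bijective (mem_chart_source F x)

/-- `A` is a projection onto the hyperplane `ker φ`, identified with `F` by dimension. It provides
the transversal coordinates completing the height. -/
lemma exists_clm_complementary {E F : Type*} [NormedAddCommGroup E] [NormedSpace ℝ E]
    [FiniteDimensional ℝ E] [NormedAddCommGroup F] [NormedSpace ℝ F] [FiniteDimensional ℝ F]
    (hdim : Module.finrank ℝ E = Module.finrank ℝ F + 1) {φ : E →L[ℝ] ℝ} (hφ : φ ≠ 0) :
    ∃ A : E →L[ℝ] F, ∀ X, A X = 0 → φ X = 0 → X = 0 := by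
  have h0 : φ.toLinearMap ≠ 0 := fun h => hφ (by ext X; exact DFunLike.congr_fun h X)
  have h1 := Module.Dual.finrank_ker_add_one_of_ne_zero h0
  let e : LinearMap.ker φ.toLinearMap ≃ₗ[ℝ] F := LinearEquiv.ofFinrankEq _ _ (by omega)
  obtain ⟨p, hp⟩ := (LinearMap.ker φ.toLinearMap).subtype.exists_leftInverse_of_injective
    (Submodule.ker_subtype _)
  refine ⟨(e.toLinearMap ∘ₗ p).toContinuousLinearMap, fun X hX hX' => ?_⟩
  have h2 : p X = 0 := e.map_eq_zero_iff.1 hX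
  have h3 : p X = ⟨X, hX'⟩ := DFunLike.congr_fun hp ⟨X, hX'⟩
  rw [h3] at h2
  exact congrArg Subtype.val h2

/-! ### Model geodesics of `ℚ_ε^k × ℝ` -/

/-- The solution `(C, S)` of `C' = -ε S`, `S' = C` with initial value `(1, 0)`. -/
structure IsCosSinPair (ε : ℝ) (C S : ℝ → ℝ) : Prop where
  smooth_cos : ContDiff ℝ ∞ C
  smooth_sin : ContDiff ℝ ∞ S
  deriv_cos : ∀ x, HasDerivAt C (-(ε * S x)) x
  deriv_sin : ∀ x, HasDerivAt S (C x) x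
  sq_add_sq : ∀ x, C x ^ 2 + ε * S x ^ 2 = 1
  cos_pos : ε ≠ 1 → ∀ x, 0 < C x
  cos_zero : C 0 = 1
  sin_zero : S 0 = 0

lemma exists_isCosSinPair {ε : ℝ} (hε : ε = -1 ∨ ε = 0 ∨ ε = 1) :
    ∃ C S : ℝ → ℝ, IsCosSinPair ε C S := by
  rcases hε with rfl | rfl | rfl
  · exact ⟨Real.cosh, Real.sinh, Real.contDiff_cosh, Real.contDiff_sinh,
      fun x => by simpa using Real.hasDerivAt_cosh x, Real.hasDerivAt_sinh,
      fun x => by linarith [Real.cosh_sq x], fun _ => Real.cosh_pos, Real.cosh_zero,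
      Real.sinh_zero⟩
  · exact ⟨fun _ => 1, id, contDiff_const, contDiff_id,
      fun x => by simpa using hasDerivAt_const x (1 : ℝ), hasDerivAt_id, by simp, by simp, rfl,
      rfl⟩
  · exact ⟨Real.cos, Real.sin, Real.contDiff_cos, Real.contDiff_sin,
      fun x => by simpa using Real.hasDerivAt_cos x, Real.hasDerivAt_sin,
      fun x => by linarith [Real.sin_sq_add_cos_sq x], fun h => absurd rfl h, Real.cos_zero,
      Real.sin_zero⟩

section GeodesicCurve

variable {k : ℕ} {ε : ℝ} {C S : ℝ → ℝ}

/-- The curve `(C(θ(s - s₀)), S(θ(s - s₀)) e, s)`. -/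
def geodesicCurve (C S : ℝ → ℝ) (θ s₀ : ℝ) (e : EuclideanSpace ℝ (Fin k)) (s : ℝ) :
    AmbientSpace k :=
  C (θ * (s - s₀)) • ((1, 0, 0) : AmbientSpace k) +
    S (θ * (s - s₀)) • ((0, e, 0) : AmbientSpace k) + s • ddt k

lemma IsCosSinPair.hasDerivAt_cos_comp (h : IsCosSinPair ε C S) (θ s₀ s : ℝ) :
    HasDerivAt (fun s => C (θ * (s - s₀))) (-(ε * S (θ * (s - s₀))) * θ) s := by
  have h1 : HasDerivAt (fun s => θ * (s - s₀)) θ s := by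
    simpa using ((hasDerivAt_id s).sub_const s₀).const_mul θ
  exact (h.deriv_cos _).comp s h1

lemma IsCosSinPair.hasDerivAt_sin_comp (h : IsCosSinPair ε C S) (θ s₀ s : ℝ) :
    HasDerivAt (fun s => S (θ * (s - s₀))) (C (θ * (s - s₀)) * θ) s := by
  have h1 : HasDerivAt (fun s => θ * (s - s₀)) θ s := by
    simpa using ((hasDerivAt_id s).sub_const s₀).const_mul θ
  exact (h.deriv_sin _).comp s h1

lemma IsCosSinPair.deriv_geodesicCurve (h : IsCosSinPair ε C S) (θ s₀ : ℝ)
    (e : EuclideanSpace ℝ (Fin k)) :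
    deriv (geodesicCurve C S θ s₀ e) = fun s =>
      (-(ε * S (θ * (s - s₀))) * θ) • ((1, 0, 0) : AmbientSpace k) +
        (C (θ * (s - s₀)) * θ) • ((0, e, 0) : AmbientSpace k) + ddt k := by
  funext s
  have h1 := (((h.hasDerivAt_cos_comp θ s₀ s).smul_const ((1, 0, 0) : AmbientSpace k)).add
    ((h.hasDerivAt_sin_comp θ s₀ s).smul_const ((0, e, 0) : AmbientSpace k))).add
    ((hasDerivAt_id s).smul_const (ddt k))
  rw [one_smul] at h1
  exact h1.deriv

/-- The summand `0` plays the role of the tangent vector in `QProdProj_add_smul_horPart`. -/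
lemma IsCosSinPair.deriv_deriv_geodesicCurve (h : IsCosSinPair ε C S) (θ s₀ : ℝ)
    (e : EuclideanSpace ℝ (Fin k)) (s : ℝ) :
    deriv (deriv (geodesicCurve C S θ s₀ e)) s =
      0 + (-(ε * θ ^ 2)) • horPart (geodesicCurve C S θ s₀ e s) := by
  rw [h.deriv_geodesicCurve]
  have h1 := (((((h.hasDerivAt_sin_comp θ s₀ s).const_mul ε).neg.mul_const θ).smul_const
    ((1, 0, 0) : AmbientSpace k)).add
    (((h.hasDerivAt_cos_comp θ s₀ s).mul_const θ).smul_const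
      ((0, e, 0) : AmbientSpace k))).add_const (ddt k)
  refine h1.deriv.trans ?_
  ext <;> simp [geodesicCurve, horPart, ddt] <;> ring

/-- The alternative `θ = 0` serves `k = 0`, where there is no unit vector `e`. -/
lemma IsCosSinPair.geodesicCurve_mem (h : IsCosSinPair ε C S) {θ : ℝ} (s₀ : ℝ)
    {e : EuclideanSpace ℝ (Fin k)} (he : θ = 0 ∨ ‖e‖ = 1) (s : ℝ) :
    geodesicCurve C S θ s₀ e s ∈ QProd ε k := by
  constructor
  · have h1 : (geodesicCurve C S θ s₀ e s).1 = C (θ * (s - s₀)) := by simp [geodesicCurve, ddt]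
    have h2 : (geodesicCurve C S θ s₀ e s).2.1 = S (θ * (s - s₀)) • e := by
      simp [geodesicCurve, ddt]
    have h3 := h.sq_add_sq (θ * (s - s₀))
    rw [h1, h2, norm_smul, mul_pow, Real.norm_eq_abs, sq_abs]
    rcases he with rfl | he
    · rw [zero_mul, h.sin_zero] at *
      simp [h.cos_zero]
    · rw [he]; simpa using h3
  · intro hne
    simpa [geodesicCurve, ddt] using h.cos_pos hne _

lemma IsCosSinPair.isTubeCurve (h : IsCosSinPair ε C S) {θ : ℝ} (s₀ : ℝ)
    {e : EuclideanSpace ℝ (Fin k)} (he : θ = 0 ∨ ‖e‖ = 1) {J : Set ℝ} (hJ : IsOpen J)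
    (hJ' : J.OrdConnected) : IsTubeCurve ε (geodesicCurve C S θ s₀ e) J where
  isOpen := hJ
  interval := hJ'
  smooth := by
    have h1 := h.smooth_cos
    have h2 := h.smooth_sin
    unfold geodesicCurve
    fun_prop
  mem s _ := h.geodesicCurve_mem s₀ he s
  height s _ := by
    have : (fun s => (geodesicCurve C S θ s₀ e s).2.2) = id := by
      funext s; simp [geodesicCurve, ddt]
    rw [this]; simp

lemma IsCosSinPair.isGeodesicOn (h : IsCosSinPair ε C S) {θ : ℝ} (s₀ : ℝ)
    {e : EuclideanSpace ℝ (Fin k)} (he : θ = 0 ∨ ‖e‖ = 1) (J : Set ℝ) :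
    IsGeodesicOn ε (geodesicCurve C S θ s₀ e) J := by
  intro s _
  rw [h.deriv_deriv_geodesicCurve]
  exact QProdProj_add_smul_horPart (h.geodesicCurve_mem s₀ he s)
    (by simp [QProdTangent, QProdConormal]) _

end GeodesicCurve

/-! ### Height slices as bases of the tube -/

section Slice

variable {E : Type*} [NormedAddCommGroup E] [NormedSpace ℝ E] {n k : ℕ} {ε : ℝ}
  {f η : E → AmbientSpace n} {V : Set E}
  {E' H' : Type*} [NormedAddCommGroup E'] [NormedSpace ℝ E'] [TopologicalSpace H']
  {I' : ModelWithCorners ℝ E' H'} {N : Type*} [TopologicalSpace N] [ChartedSpace H' N]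

/-- A level set of the height is an immersed submanifold of `ℚ_εⁿ` along which the horizontal part
of `η` is a parallel normal vector field. -/
lemma IsParallelChart.isTubeBase_slice (hε : ε = -1 ∨ ε = 0 ∨ ε = 1)
    (h : IsParallelChart ε f η V) {c : ℝ} (hc : ∀ y ∈ V, (η y).2.2 = c) {ς : N → E}
    (hς : ContMDiff I' 𝓘(ℝ, E) ∞ ς) (hςV : ∀ x, ς x ∈ V) {s₀ : ℝ}
    (hs : ∀ x, (f (ς x)).2.2 = s₀)
    (hinj : ∀ x, Function.Injective (mfderiv I' 𝓘(ℝ, E) ς x))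
    (hsurj : ∀ x v, (fderiv ℝ f (ς x) v).2.2 = 0 → ∃ X, mfderiv I' 𝓘(ℝ, E) ς x X = v)
    {a : Fin k → ℝ} (ha : ∀ i j, a i * a j * (c - c ^ 2) = if i = j then 1 else 0) :
    IsTubeBase I' ε (fun x => horPart (f (ς x))) (fun i x => a i • horPart (η (ς x))) := by
  have hcomp : ∀ {φ : E → AmbientSpace n}, ContDiffOn ℝ ∞ φ V →
      ContMDiff I' 𝓘(ℝ, AmbientSpace n) ∞ (fun x => φ (ς x)) := fun {φ} hφ =>
    contMDiffOn_univ.1 (hφ.contMDiffOn.comp hς.contMDiffOn fun x _ => hςV x)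
  have hd : ∀ {φ : E → AmbientSpace n}, ContDiffOn ℝ ∞ φ V → ∀ x (X : TangentSpace I' x),
      diffAt I' (fun x => φ (ς x)) x X = fderiv ℝ φ (ς x) (mfderiv I' 𝓘(ℝ, E) ς x X) := by
    intro φ hφ x X
    have h1 := ((hφ.differentiableOn (by simp)).differentiableAt
      (h.isOpen.mem_nhds (hςV x))).hasFDerivAt.hasMFDerivAt
    have h2 := (hς.mdifferentiable (by simp) x).hasMFDerivAt
    exact DFunLike.congr_fun (h1.comp x h2).mfderiv X
  have hg : ∀ x (X : TangentSpace I' x), diffAt I' (fun x => horPart (f (ς x))) x X =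
      horPart (fderiv ℝ f (ς x) (mfderiv I' 𝓘(ℝ, E) ς x X)) := by
    intro x X
    rw [← hd h.smooth]
    exact mfderiv_clm_comp (horPartL n) ((hcomp h.smooth).mdifferentiable (by simp) x) X
  have hheight : ∀ x (X : TangentSpace I' x),
      (fderiv ℝ f (ς x) (mfderiv I' 𝓘(ℝ, E) ς x X)).2.2 = 0 := by
    intro x X
    rw [← hd h.smooth]
    exact height_diffAt ((hcomp h.smooth).mdifferentiable (by simp) x) (.of_forall hs) X
  have hhor : ∀ v : AmbientSpace n, v.2.2 = 0 → horPart v = v := fun v hv => by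
    conv_rhs => rw [eq_horPart_add v, hv, zero_smul, add_zero]
  have hg' : ∀ x (X : TangentSpace I' x), diffAt I' (fun x => horPart (f (ς x))) x X =
      fderiv ℝ f (ς x) (mfderiv I' 𝓘(ℝ, E) ς x X) := fun x X => by
    rw [hg, hhor _ (hheight x X)]
  have hξ : ∀ i x (X : TangentSpace I' x), diffAt I' (fun x => a i • horPart (η (ς x))) x X =
      a i • horPart (fderiv ℝ η (ς x) (mfderiv I' 𝓘(ℝ, E) ς x X)) := by
    intro i x X
    rw [← hd h.smooth_normal]
    exact mfderiv_clm_comp (a i • horPartL n)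
      ((hcomp h.smooth_normal).mdifferentiable (by simp) x) X
  refine ⟨⟨(horPartL n).contDiff.contMDiff.comp (hcomp h.smooth),
    fun x => horPart_mem_QProd (h.mem _ (hςV x)), fun x => ?_⟩, fun _ => rfl,
    fun i x => by simp [horPart], fun i => ⟨?_, fun x _ => ⟨?_, fun X => ?_⟩, fun x _ X => ?_⟩,
    fun i j x => ?_⟩
  · intro X Y hXY
    rw [hg', hg'] at hXY
    exact hinj x (h.injective _ (hςV x) hXY)
  · exact ((a i • horPartL n).contDiff.contMDiff.comp (hcomp h.smooth_normal)).contMDiffOn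
  · have h1 : QProdConormal ε (f (ς x)) (η (ς x)) = 0 := h.tangent _ (hςV x)
    change QProdConormal ε (horPart (f (ς x))) (a i • horPart (η (ς x))) = 0
    rw [← conormalForm_apply, map_smul, conormalForm_apply, QProdConormal_horPart_left,
      QProdConormal_horPart_right, h1, smul_zero]
  · have h0 : ambientForm ε (fderiv ℝ f (ς x) (mfderiv I' 𝓘(ℝ, E) ς x X)) (η (ς x)) = 0 :=
      h.orthogonal _ (hςV x) _
    rw [hg', ← ambientBilin_apply, map_smul, ambientBilin_apply, ambientForm_horPart_right,
      h0, hheight]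
    simp
  -- Along the slice `f_* X` has height zero, so the position term disappears. Since `Dη` has height
  -- zero too, `Y` is tangent to the slice.
  · obtain ⟨Y, hY⟩ := h.exists_fderiv_normal_eq hε (hςV x) (mfderiv I' 𝓘(ℝ, E) ς x X)
    rw [hheight, mul_zero, zero_mul, zero_smul, add_zero] at hY
    have hYh : (fderiv ℝ f (ς x) Y).2.2 = 0 := by
      rw [← hY]; exact h.fderiv_normal_height hε (hςV x) _
    obtain ⟨Z, rfl⟩ := hsurj x Y hYh
    refine ⟨a i • Z, ?_, by simp [QProdTangent, QProdConormal], fun _ => by simp [ambientForm]⟩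
    rw [add_zero, covDerivAlong, hξ, hY, hhor _ hYh, map_smul, hg']
    refine QProdProj_of_tangent ?_
    have h1 : QProdConormal ε (f (ς x)) _ = 0 :=
      h.fderiv_tangent (hςV x) (mfderiv I' 𝓘(ℝ, E) ς x Z)
    change QProdConormal ε (horPart (f (ς x))) _ = 0
    rw [← conormalForm_apply, map_smul, conormalForm_apply, QProdConormal_horPart_left, h1,
      smul_zero]
  · rw [← ambientBilin_apply, map_smul, map_smul, smul_apply, ambientBilin_apply,
      ambientForm_horPart_horPart, h.ambientForm_normal_self (hςV x), hc _ (hςV x), ← ha i j]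
    simp only [smul_eq_mul]; ring

end Slice

/-! ### First integrals of `T` -/

section LocalForm

variable {E : Type*} [NormedAddCommGroup E] [NormedSpace ℝ E] {n : ℕ} {ε : ℝ}
  {f η : E → AmbientSpace n} {V : Set E} {C S : ℝ → ℝ} {θ s₀ r : ℝ}

/-- The point where the geodesic of `ℚ_εⁿ × ℝ` with direction `∂/∂t - η` through `f y` meets the
slice of height `s₀` (projected to `ℚ_εⁿ`). -/
def footPoint (f η : E → AmbientSpace n) (C S : ℝ → ℝ) (θ s₀ r : ℝ) (y : E) : AmbientSpace n :=
  C (θ * ((f y).2.2 - s₀)) • horPart (f y) + (S (θ * ((f y).2.2 - s₀)) * r) • horPart (η y)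

/-- The horizontal direction at `footPoint` of the same geodesic. -/
def footDirection (ε : ℝ) (f η : E → AmbientSpace n) (C S : ℝ → ℝ) (θ s₀ r : ℝ) (y : E) :
    AmbientSpace n :=
  (ε * S (θ * ((f y).2.2 - s₀))) • horPart (f y) -
    (C (θ * ((f y).2.2 - s₀)) * r) • horPart (η y)

/-- The pair of foot vectors is a rotation of `(horPart f, -r • horPart η)`; this applies the
inverse rotation, through `C ^ 2 + ε * S ^ 2 = 1`. -/
lemma IsCosSinPair.footPoint_add {E : Type*} {f η : E → AmbientSpace n}
    (h : IsCosSinPair ε C S) (y : E) :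
    C (θ * ((f y).2.2 - s₀)) • footPoint f η C S θ s₀ r y +
      S (θ * ((f y).2.2 - s₀)) • footDirection ε f η C S θ s₀ r y = horPart (f y) := by
  have h1 := h.sq_add_sq (θ * ((f y).2.2 - s₀))
  have h2 : C (θ * ((f y).2.2 - s₀)) • footPoint f η C S θ s₀ r y +
      S (θ * ((f y).2.2 - s₀)) • footDirection ε f η C S θ s₀ r y =
      (C (θ * ((f y).2.2 - s₀)) ^ 2 + ε * S (θ * ((f y).2.2 - s₀)) ^ 2) • horPart (f y) := by
    rw [footPoint, footDirection]; module
  rw [h2, h1, one_smul]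

lemma IsCosSinPair.footPoint_slice {E : Type*} {f η : E → AmbientSpace n}
    (h : IsCosSinPair ε C S) {y : E} (hy : (f y).2.2 = s₀) :
    footPoint f η C S θ s₀ r y = horPart (f y) := by
  simp [footPoint, hy, h.cos_zero, h.sin_zero]

lemma IsCosSinPair.footDirection_slice {E : Type*} {f η : E → AmbientSpace n}
    (h : IsCosSinPair ε C S) {y : E} (hy : (f y).2.2 = s₀) :
    footDirection ε f η C S θ s₀ r y = (-r) • horPart (η y) := by
  simp [footDirection, hy, h.cos_zero, h.sin_zero]

lemma IsCosSinPair.hasFDerivAt_cos_height (h : IsCosSinPair ε C S) {y : E}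
    (hf : DifferentiableAt ℝ f y) :
    HasFDerivAt (fun y => C (θ * ((f y).2.2 - s₀)))
      ((-(ε * S (θ * ((f y).2.2 - s₀))) * θ) • (heightL n).comp (fderiv ℝ f y)) y :=
  HasDerivAt.comp_hasFDerivAt (h₂ := fun s => C (θ * (s - s₀))) (f := fun y => (f y).2.2) y
    (h.hasDerivAt_cos_comp θ s₀ (f y).2.2) ((heightL n).hasFDerivAt.comp y hf.hasFDerivAt)

lemma IsCosSinPair.hasFDerivAt_sin_height (h : IsCosSinPair ε C S) {y : E}
    (hf : DifferentiableAt ℝ f y) :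
    HasFDerivAt (fun y => S (θ * ((f y).2.2 - s₀)))
      ((C (θ * ((f y).2.2 - s₀)) * θ) • (heightL n).comp (fderiv ℝ f y)) y :=
  HasDerivAt.comp_hasFDerivAt (h₂ := fun s => S (θ * (s - s₀))) (f := fun y => (f y).2.2) y
    (h.hasDerivAt_sin_comp θ s₀ (f y).2.2) ((heightL n).hasFDerivAt.comp y hf.hasFDerivAt)

lemma IsCosSinPair.fderiv_footPoint (h : IsCosSinPair ε C S) {y : E}
    (hf : DifferentiableAt ℝ f y) (hη : DifferentiableAt ℝ η y) (X : E) :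
    fderiv ℝ (footPoint f η C S θ s₀ r) y X =
      C (θ * ((f y).2.2 - s₀)) • horPart (fderiv ℝ f y X) +
      (-(ε * S (θ * ((f y).2.2 - s₀))) * θ * (fderiv ℝ f y X).2.2) • horPart (f y) +
      ((S (θ * ((f y).2.2 - s₀)) * r) • horPart (fderiv ℝ η y X) +
      (C (θ * ((f y).2.2 - s₀)) * θ * (fderiv ℝ f y X).2.2 * r) • horPart (η y)) := by
  have h1 := ((h.hasFDerivAt_cos_height (θ := θ) (s₀ := s₀) hf).smul
    ((horPartL n).hasFDerivAt.comp y hf.hasFDerivAt)).add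
    (((h.hasFDerivAt_sin_height (θ := θ) (s₀ := s₀) hf).mul_const r).smul
      ((horPartL n).hasFDerivAt.comp y hη.hasFDerivAt))
  refine (DFunLike.congr_fun h1.fderiv X).trans ?_
  simp [horPartL_apply, heightL_apply]
  module

lemma IsCosSinPair.fderiv_footDirection (h : IsCosSinPair ε C S) {y : E}
    (hf : DifferentiableAt ℝ f y) (hη : DifferentiableAt ℝ η y) (X : E) :
    fderiv ℝ (footDirection ε f η C S θ s₀ r) y X =
      (ε * S (θ * ((f y).2.2 - s₀))) • horPart (fderiv ℝ f y X) +
      (ε * (C (θ * ((f y).2.2 - s₀)) * θ * (fderiv ℝ f y X).2.2)) • horPart (f y) -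
      ((C (θ * ((f y).2.2 - s₀)) * r) • horPart (fderiv ℝ η y X) +
      (-(ε * S (θ * ((f y).2.2 - s₀))) * θ * (fderiv ℝ f y X).2.2 * r) • horPart (η y)) := by
  have h1 := (((h.hasFDerivAt_sin_height (θ := θ) (s₀ := s₀) hf).const_mul ε).smul
    ((horPartL n).hasFDerivAt.comp y hf.hasFDerivAt)).sub
    (((h.hasFDerivAt_cos_height (θ := θ) (s₀ := s₀) hf).mul_const r).smul
      ((horPartL n).hasFDerivAt.comp y hη.hasFDerivAt))
  refine (DFunLike.congr_fun h1.fderiv X).trans ?_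
  simp [horPartL_apply, heightL_apply]
  module

lemma IsCosSinPair.contDiffOn_height (h : IsParallelChart ε f η V) {φ : ℝ → ℝ}
    (hφ : ContDiff ℝ ∞ φ) : ContDiffOn ℝ ∞ (fun y => φ (θ * ((f y).2.2 - s₀))) V :=
  hφ.comp_contDiffOn (contDiffOn_const.mul
    (((heightL n).contDiff.comp_contDiffOn h.smooth).sub contDiffOn_const))

lemma IsCosSinPair.contDiffOn_footPoint (hCS : IsCosSinPair ε C S)
    (h : IsParallelChart ε f η V) : ContDiffOn ℝ ∞ (footPoint f η C S θ s₀ r) V :=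
  ((contDiffOn_height h hCS.smooth_cos).smul
    ((horPartL n).contDiff.comp_contDiffOn h.smooth)).add
  (((contDiffOn_height h hCS.smooth_sin).mul contDiffOn_const).smul
    ((horPartL n).contDiff.comp_contDiffOn h.smooth_normal))

lemma IsCosSinPair.contDiffOn_footDirection (hCS : IsCosSinPair ε C S)
    (h : IsParallelChart ε f η V) : ContDiffOn ℝ ∞ (footDirection ε f η C S θ s₀ r) V :=
  ((contDiffOn_const.mul (contDiffOn_height h hCS.smooth_sin)).smul
    ((horPartL n).contDiff.comp_contDiffOn h.smooth)).sub
  (((contDiffOn_height h hCS.smooth_cos).mul contDiffOn_const).smul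
    ((horPartL n).contDiff.comp_contDiffOn h.smooth_normal))

/-- `footPoint` and `footDirection` are first integrals of the tangential part of `∂/∂t`. -/
lemma IsParallelChart.fderiv_foot_eq_zero (hε : ε = -1 ∨ ε = 0 ∨ ε = 1)
    (h : IsParallelChart ε f η V) (hCS : IsCosSinPair ε C S) {y : E} (hy : y ∈ V) {T : E}
    (hT : fderiv ℝ f y T = ddt n - η y)
    (hr : (θ * (1 - (η y).2.2) * r - 1) • horPart (η y) = 0)
    (hθ : θ * (1 - (η y).2.2) = (1 - (η y).2.2) * (η y).2.2 * r) :
    fderiv ℝ (footPoint f η C S θ s₀ r) y T = 0 ∧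
      fderiv ℝ (footDirection ε f η C S θ s₀ r) y T = 0 := by
  have h1 : (fderiv ℝ f y T).2.2 = 1 - (η y).2.2 := by rw [hT]; simp [ddt]
  have h2 : horPart (fderiv ℝ f y T) = -horPart (η y) := by
    rw [hT, ← horPartL_apply, map_sub, horPartL_apply, horPartL_apply]
    ext <;> simp [horPart, ddt]
  have h3 : horPart (fderiv ℝ η y T) =
      (ε * (1 - (η y).2.2) * (η y).2.2) • horPart (f y) := by
    rw [h.fderiv_normal_of_splitting hε hy hT, ← horPartL_apply, map_smul]; rfl
  rw [hCS.fderiv_footPoint (h.differentiableAt hy) (h.differentiableAt_normal hy),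
    hCS.fderiv_footDirection (h.differentiableAt hy) (h.differentiableAt_normal hy), h1, h2, h3]
  have e1 : θ * (1 - (η y).2.2) - (1 - (η y).2.2) * (η y).2.2 * r = 0 := sub_eq_zero.2 hθ
  constructor
  -- After substitution of `D_T πf` and `D_T πη`, the derivative is a combination of the two
  -- relations on the constants: the `η` terms cancel by `hr`, the `f` terms by `e1`.
  · have : C (θ * ((f y).2.2 - s₀)) • ((θ * (1 - (η y).2.2) * r - 1) • horPart (η y)) -
        (ε * S (θ * ((f y).2.2 - s₀)) *
          (θ * (1 - (η y).2.2) - (1 - (η y).2.2) * (η y).2.2 * r)) • horPart (f y) = 0 := by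
      rw [hr, e1]; simp
    rw [← this]; module
  · have : (ε * S (θ * ((f y).2.2 - s₀))) • ((θ * (1 - (η y).2.2) * r - 1) • horPart (η y)) +
        (ε * C (θ * ((f y).2.2 - s₀)) *
          (θ * (1 - (η y).2.2) - (1 - (η y).2.2) * (η y).2.2 * r)) • horPart (f y) = 0 := by
      rw [hr, e1]; simp
    rw [← this]; module

end LocalForm

/-! ### Slices of a local diffeomorphism and the constants of the geodesic -/

section Product

variable {E : Type*} [NormedAddCommGroup E] [NormedSpace ℝ E]
  {F : Type*} [NormedAddCommGroup F] [NormedSpace ℝ F]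

/-- The slices `u ↦ Φ(u, s₀)` of a local diffeomorphism. -/
lemma mfderiv_slice_of_diffeo {Φ : OpenPartialHomeomorph (F × ℝ) E}
    (hΦ : ContDiffOn ℝ ∞ Φ Φ.source) (hΦ' : ContDiffOn ℝ ∞ Φ.symm Φ.target)
    (N : TopologicalSpace.Opens F) {s₀ : ℝ} (hN : ∀ u ∈ N, (u, s₀) ∈ Φ.source)
    {h : E → ℝ} (hh : ∀ y ∈ Φ.target, (Φ.symm y).2 = h y) :
    ContMDiff 𝓘(ℝ, F) 𝓘(ℝ, E) ∞ (fun u : N => Φ (u, s₀)) ∧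
    ∀ x : N, Function.Injective (mfderiv 𝓘(ℝ, F) 𝓘(ℝ, E) (fun u : N => Φ (u, s₀)) x) ∧
      ∀ v, fderiv ℝ h (Φ (x, s₀)) v = 0 →
        ∃ X, mfderiv 𝓘(ℝ, F) 𝓘(ℝ, E) (fun u : N => Φ (u, s₀)) x X = v := by
  have hι : ContMDiff 𝓘(ℝ, F) 𝓘(ℝ, F × ℝ) ∞ (fun u : N => ((u : F), s₀)) :=
    contMDiff_subtype_val.prodMk_space contMDiff_const
  refine ⟨contMDiffOn_univ.1 (hΦ.contMDiffOn.comp hι.contMDiffOn fun x _ => hN x x.2),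
    fun x => ?_⟩
  have hx : ((x : F), s₀) ∈ Φ.source := hN x x.2
  have hy := Φ.map_source hx
  have h1 : HasFDerivAt Φ (fderiv ℝ Φ (x, s₀)) (x, s₀) := ((hΦ.differentiableOn
    (by simp)).differentiableAt (Φ.open_source.mem_nhds hx)).hasFDerivAt
  have h2 : HasFDerivAt Φ.symm (fderiv ℝ Φ.symm (Φ (x, s₀))) (Φ (x, s₀)) :=
    ((hΦ'.differentiableOn (by simp)).differentiableAt (Φ.open_target.mem_nhds hy)).hasFDerivAt
  have h21 : ∀ w, fderiv ℝ Φ.symm (Φ (x, s₀)) (fderiv ℝ Φ (x, s₀) w) = w := by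
    intro w
    have e1 : Φ.symm ∘ Φ =ᶠ[𝓝 ((x : F), s₀)] id :=
      Filter.mem_of_superset (Φ.open_source.mem_nhds hx) fun q hq => Φ.left_inv hq
    exact DFunLike.congr_fun
      ((h2.comp ((x : F), s₀) h1).unique ((hasFDerivAt_id _).congr_of_eventuallyEq e1)) w
  have h12 : ∀ v, fderiv ℝ Φ (x, s₀) (fderiv ℝ Φ.symm (Φ (x, s₀)) v) = v := by
    intro v
    have e1 : Φ ∘ Φ.symm =ᶠ[𝓝 (Φ (x, s₀))] id :=
      Filter.mem_of_superset (Φ.open_target.mem_nhds hy) fun q hq => Φ.right_inv hq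
    have h1' : HasFDerivAt Φ (fderiv ℝ Φ (x, s₀)) (Φ.symm (Φ (x, s₀))) := by
      rw [Φ.left_inv hx]; exact h1
    exact DFunLike.congr_fun
      ((h1'.comp _ h2).unique ((hasFDerivAt_id _).congr_of_eventuallyEq e1)) v
  have h3 : fderiv ℝ h (Φ (x, s₀)) =
      (ContinuousLinearMap.snd ℝ F ℝ).comp (fderiv ℝ Φ.symm (Φ (x, s₀))) := by
    refine HasFDerivAt.fderiv ?_
    refine (hasFDerivAt_snd.comp _ h2).congr_of_eventuallyEq ?_
    exact Filter.mem_of_superset (Φ.open_target.mem_nhds hy) fun q hq => (hh q hq).symm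
  have hval : HasMFDerivAt 𝓘(ℝ, F) 𝓘(ℝ, F) (Subtype.val : N → F) x
      (mfderiv 𝓘(ℝ, F) 𝓘(ℝ, F) (Subtype.val : N → F) x) :=
    (contMDiff_subtype_val.mdifferentiable (n := 1) (by simp) x).hasMFDerivAt
  have hbij := mfderiv_opens_val_bijective N x
  have h4 : HasFDerivAt (fun u : F => Φ (u, s₀))
      ((fderiv ℝ Φ (x, s₀)).comp (.inl ℝ F ℝ)) x :=
    h1.comp (x : F) (hasFDerivAt_prodMk_left (x : F) s₀)
  have h5 : ∀ X : TangentSpace 𝓘(ℝ, F) x,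
      mfderiv 𝓘(ℝ, F) 𝓘(ℝ, E) (fun u : N => Φ (u, s₀)) x X =
      fderiv ℝ Φ (x, s₀) (mfderiv 𝓘(ℝ, F) 𝓘(ℝ, F) (Subtype.val : N → F) x X, 0) := fun X =>
    DFunLike.congr_fun (h4.hasMFDerivAt.comp x hval).mfderiv X
  constructor
  · intro X Y hXY
    rw [h5, h5] at hXY
    have h6 := congrArg (fderiv ℝ Φ.symm (Φ (x, s₀))) hXY
    rw [h21, h21] at h6
    exact hbij.1 (congrArg Prod.fst h6)
  · intro v hv
    rw [h3] at hv
    obtain ⟨X, hX⟩ := hbij.2 (fderiv ℝ Φ.symm (Φ (x, s₀)) v).1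
    refine ⟨X, ?_⟩
    rw [h5, hX]
    conv_rhs => rw [← h12 v]
    -- The height is the second coordinate of `Φ.symm`, so `dh(v) = 0` says that `v` comes from a
    -- vector with zero `ℝ` component.
    exact congrArg _ (Prod.ext rfl hv.symm)

end Product

/-- The constants of the geodesic with `⟨η, ∂/∂t⟩ = c`: the codimension `k`, the speed `θ` of its
horizontal part, and the inverse length `r` of the horizontal part of `η`. -/
lemma exists_geodesic_constants {c : ℝ} (h0 : 0 ≤ c) (h1 : c < 1) :
    ∃ (k : ℕ) (e : EuclideanSpace ℝ (Fin k)) (θ r : ℝ), (∀ i, e i = 1) ∧ (θ = 0 ∨ ‖e‖ = 1) ∧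
      (∀ i j : Fin k, -r * -r * (c - c ^ 2) = if i = j then 1 else 0) ∧
      (c = 0 ∨ θ * (1 - c) * r - 1 = 0) ∧ θ * (1 - c) = (1 - c) * c * r ∧
      (c = 0 ∧ k = 0 ∧ θ = 0 ∨ k = 1) := by
  rcases h0.eq_or_lt with rfl | hc
  -- For `c = 0` the field `η` vanishes: no normal field is needed and the geodesic is vertical.
  · exact ⟨0, 0, 0, 0, fun i => i.elim0, .inl rfl, fun i => i.elim0, .inl rfl, by simp,
      .inl ⟨rfl, rfl, rfl⟩⟩
  · have hκ : 0 < c * (1 - c) := mul_pos hc (sub_pos.2 h1)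
    have hs : √(c * (1 - c)) ≠ 0 := (Real.sqrt_pos.2 hκ).ne'
    have hs2 : √(c * (1 - c)) ^ 2 = c * (1 - c) := Real.sq_sqrt hκ.le
    have hc1 : 1 - c ≠ 0 := (sub_pos.2 h1).ne'
    -- The horizontal part of `∂/∂t - η` has length `√(c (1 - c))` and its height is `1 - c`; `θ` is
    -- the quotient, the horizontal speed per unit of height.
    refine ⟨1, WithLp.toLp 2 fun _ => 1, √(c * (1 - c)) / (1 - c), (√(c * (1 - c)))⁻¹,
      fun _ => rfl, .inr ?_, fun i j => ?_, .inr ?_, ?_, .inr rfl⟩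
    · simp [EuclideanSpace.norm_eq]
    · rw [if_pos (Subsingleton.elim i j)]
      field_simp
      linarith
    · field_simp
      simp
    · field_simp
      linarith

/-! ### The local normal form in a vector space -/

section LocalForm

variable {E : Type*} [NormedAddCommGroup E] [NormedSpace ℝ E] [FiniteDimensional ℝ E]
  {F : Type*} [NormedAddCommGroup F] [NormedSpace ℝ F] [FiniteDimensional ℝ F] {n : ℕ} {ε : ℝ}
  {f η : E → AmbientSpace n} {U : Set E}

theorem IsParallelChart.exists_local_form (hε : ε = -1 ∨ ε = 0 ∨ ε = 1)
    (hdim : Module.finrank ℝ E = Module.finrank ℝ F + 1) (hU : IsParallelChart ε f η U) {x₀ : E}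
    (hx₀ : x₀ ∈ U) :
    ∃ (k : ℕ) (N : TopologicalSpace.Opens F) (g : N → AmbientSpace n)
      (ξ : Fin k → N → AmbientSpace n) (α : ℝ → AmbientSpace k) (J : Set ℝ)
      (Φ : OpenPartialHomeomorph (F × ℝ) E),
      IsTubeBase 𝓘(ℝ, F) ε g ξ ∧ IsTubeCurve ε α J ∧ IsGeodesicOn ε α J ∧
      Φ.source = (N : Set F) ×ˢ J ∧ x₀ ∈ Φ.target ∧ Φ.target ⊆ U ∧
      ContDiffOn ℝ ∞ Φ Φ.source ∧ ContDiffOn ℝ ∞ Φ.symm Φ.target ∧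
      ∀ (u : N) (s : ℝ), s ∈ J → f (Φ (u, s)) = tubeMap g ξ α (u, s) := by
  -- A ball is convex, which makes the height of `η` constant on it.
  obtain ⟨ρ, hρ, hρU⟩ := Metric.isOpen_iff.1 hU.isOpen x₀ hx₀
  have h := hU.mono Metric.isOpen_ball hρU
  set V := Metric.ball x₀ ρ with hV
  have hx : x₀ ∈ V := Metric.mem_ball_self hρ
  set c := (η x₀).2.2 with hcdef
  have hc : ∀ y ∈ V, (η y).2.2 = c := fun y hy =>
    h.height_eq_of_convex hε (convex_ball _ _) hy hx
  obtain ⟨hc0, hc1⟩ := h.height_lt_one hε hx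
  obtain ⟨k, e, θ, r, he, heθ, har, hr, hθ, hk⟩ := exists_geodesic_constants hc0 hc1
  obtain ⟨C, S, hCS⟩ := exists_isCosSinPair hε
  set s₀ := (f x₀).2.2 with hs₀
  have hη0 : c = 0 → ∀ y ∈ V, horPart (η y) = 0 := fun h0 y hy => by
    have h1 := (ambientForm_self_nonneg hε (h.mem y hy) (h.tangent y hy)).2
      ((h.ambientForm_normal_self hy).trans ((hc y hy).trans h0))
    rw [h1]; rfl
  choose! T hT0 hT using h.splitting
  have hfoot : ∀ y ∈ V, fderiv ℝ (footPoint f η C S θ s₀ r) y (T y) = 0 ∧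
      fderiv ℝ (footDirection ε f η C S θ s₀ r) y (T y) = 0 := by
    intro y hy
    refine h.fderiv_foot_eq_zero hε hCS hy (hT y hy) ?_ (by rw [hc y hy]; exact hθ)
    rw [hc y hy]
    rcases hr with h0 | h0
    · rw [hη0 h0 y hy, smul_zero]
    · rw [h0, zero_smul]
  set hgt : E → ℝ := fun y => (f y).2.2 with hhgt
  have hgts : ContDiffOn ℝ ∞ hgt V := (heightL n).contDiff.comp_contDiffOn h.smooth
  have hgtd : ∀ y ∈ V, ∀ X, fderiv ℝ hgt y X = (fderiv ℝ f y X).2.2 := fun y hy X =>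
    DFunLike.congr_fun
      ((heightL n).hasFDerivAt.comp y (h.differentiableAt hy).hasFDerivAt).fderiv X
  have hhT : ∀ y ∈ V, fderiv ℝ hgt y (T y) ≠ 0 := by
    intro y hy
    rw [hgtd y hy, hT y hy]
    have : (ddt n - η y).2.2 = 1 - c := by simp [ddt, hc y hy]
    rw [this]; exact (sub_pos.2 hc1).ne'
  -- The slice coordinates are `A ∘ L ∘ footPoint` with `L` a left inverse of `df` at `x₀`: this is
  -- a first integral of `T`, and its differential at `x₀` agrees with `A` on the kernel of `dh`.
  obtain ⟨A, hA⟩ := exists_clm_complementary (F := F) hdim (φ := fderiv ℝ hgt x₀)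
    fun h0 => hhT x₀ hx (by rw [h0]; rfl)
  obtain ⟨L, hL⟩ := (fderiv ℝ f x₀).toLinearMap.exists_leftInverse_of_injective
    (LinearMap.ker_eq_bot.2 (h.injective x₀ hx))
  set AL : AmbientSpace n →L[ℝ] F := A.comp L.toContinuousLinearMap
  have hGs := hCS.contDiffOn_footPoint (θ := θ) (s₀ := s₀) (r := r) h
  have hΞs := hCS.contDiffOn_footDirection (θ := θ) (s₀ := s₀) (r := r) h
  have hPd : ∀ y ∈ V, ∀ X, fderiv ℝ (fun y => AL (footPoint f η C S θ s₀ r y)) y X =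
      AL (fderiv ℝ (footPoint f η C S θ s₀ r) y X) := fun y hy X =>
    DFunLike.congr_fun (AL.hasFDerivAt.comp y ((hGs.differentiableOn (by simp)).differentiableAt
      (h.isOpen.mem_nhds hy)).hasFDerivAt).fderiv X
  obtain ⟨Φ, R, hR, hsrc, hxt, htV, hΦ, hΦ', hsymm, hconst⟩ := exists_straightening hdim h.isOpen hx
    (AL.contDiff.comp_contDiffOn hGs) hgts (fun X hX hX' => by
      refine hA X ?_ hX'
      have h2 := hPd x₀ hx X
      rw [hCS.fderiv_footPoint (h.differentiableAt hx) (h.differentiableAt_normal hx)] at h2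
      rw [hgtd x₀ hx] at hX'
      have h3 : horPart (fderiv ℝ f x₀ X) = fderiv ℝ f x₀ X := by
        conv_rhs => rw [eq_horPart_add (fderiv ℝ f x₀ X), hX', zero_smul, add_zero]
      rw [hX', ← hs₀, sub_self, mul_zero, hCS.cos_zero, hCS.sin_zero, h3] at h2
      have h4 : L (fderiv ℝ f x₀ X) = X := DFunLike.congr_fun hL X
      have h5 : AL (fderiv ℝ f x₀ X) = A X := congrArg A h4
      rw [← h5]
      simp only [one_smul, mul_zero, zero_mul, zero_smul, add_zero] at h2
      exact h2.symm.trans hX) (T := T)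
    (fun y hy => (hPd y hy _).trans (by rw [(hfoot y hy).1, map_zero])) hhT
  let N : TopologicalSpace.Opens F :=
    ⟨Metric.ball (AL (footPoint f η C S θ s₀ r x₀)) R, Metric.isOpen_ball⟩
  have hs₀J : s₀ ∈ Metric.ball s₀ R := Metric.mem_ball_self hR
  have hsrc' : ∀ (u : N) s, s ∈ Metric.ball s₀ R → ((u : F), s) ∈ Φ.source := fun u s hs =>
    hsrc ▸ ⟨u.2, hs⟩
  have hheight : ∀ (u : N) s, s ∈ Metric.ball s₀ R → (f (Φ (u, s))).2.2 = s := by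
    intro u s hs
    have h2 := hsymm _ (Φ.map_source (hsrc' u s hs))
    rw [Φ.left_inv (hsrc' u s hs)] at h2
    exact (congrArg Prod.snd h2).symm
  obtain ⟨hς, hς'⟩ := mfderiv_slice_of_diffeo hΦ hΦ' N (s₀ := s₀)
    (fun u hu => hsrc' ⟨u, hu⟩ s₀ hs₀J) (h := hgt) fun y hy => congrArg Prod.snd (hsymm y hy)
  have hmem : ∀ (u : N) s, s ∈ Metric.ball s₀ R → Φ (u, s) ∈ V := fun u s hs =>
    htV (Φ.map_source (hsrc' u s hs))
  refine ⟨k, N, fun u => horPart (f (Φ (u, s₀))), fun i u => (-r) • horPart (η (Φ (u, s₀))),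
    geodesicCurve C S θ s₀ e, Metric.ball s₀ R, Φ,
    h.isTubeBase_slice hε hc hς (fun u => hmem u s₀ hs₀J) (fun u => hheight u s₀ hs₀J)
      (fun u => (hς' u).1) (fun u v hv => (hς' u).2 v ?_) har,
    hCS.isTubeCurve s₀ heθ Metric.isOpen_ball (convex_ball _ _).ordConnected,
    hCS.isGeodesicOn s₀ heθ _, hsrc, hxt, htV.trans hρU, hΦ, hΦ', fun u s hs => ?_⟩
  · rw [hgtd _ (hmem u s₀ hs₀J)]; exact hv
  · have h1 := hheight u s hs
    have h2 := hheight u s₀ hs₀J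
    have h3 := hconst (footPoint f η C S θ s₀ r) (hGs.differentiableOn (by simp))
      (fun y hy => (hfoot y hy).1) u s s₀ (hsrc' u s hs) (hsrc' u s₀ hs₀J)
    have h4 := hconst (footDirection ε f η C S θ s₀ r) (hΞs.differentiableOn (by simp))
      (fun y hy => (hfoot y hy).2) u s s₀ (hsrc' u s hs) (hsrc' u s₀ hs₀J)
    rw [hCS.footPoint_slice h2] at h3
    rw [hCS.footDirection_slice h2] at h4
    have h5 := hCS.footPoint_add (f := f) (η := η) (θ := θ) (s₀ := s₀) (r := r) (Φ (u, s))
    rw [h3, h4, h1] at h5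
    rw [eq_horPart_add (f (Φ (u, s))), ← h5, h1, tubeMap_eq_frameMap, frameMap]
    have e1 : (geodesicCurve C S θ s₀ e s).1 = C (θ * (s - s₀)) := by simp [geodesicCurve, ddt]
    have e2 : ∀ i, (geodesicCurve C S θ s₀ e s).2.1 i = S (θ * (s - s₀)) := fun i => by
      simp [geodesicCurve, ddt, he]
    have e3 : (geodesicCurve C S θ s₀ e s).2.2 = s := by simp [geodesicCurve, ddt]
    simp only [e1, e2, e3]
    rw [Finset.sum_const, Finset.card_univ, Fintype.card_fin]
    -- For `k = 0` the sum is empty, matching `S 0 = 0`; for `k = 1` it is the single term with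
    -- coefficient `S`.
    rcases hk with ⟨-, rfl, rfl⟩ | rfl
    · simp [hCS.sin_zero]
    · simp

end LocalForm

/-! ### Passage between the manifold and its charts -/

section Transfer

variable {E H : Type*} [NormedAddCommGroup E] [NormedSpace ℝ E] [TopologicalSpace H]
  {I : ModelWithCorners ℝ E H} {M : Type*} [TopologicalSpace M] [ChartedSpace H M] {n : ℕ}
  {ε : ℝ} [I.Boundaryless] [IsManifold I ∞ M]

lemma isParallelChart_extChartAt {f : M → AmbientSpace n} {T : (x : M) → TangentSpace I x}
    {η : M → AmbientSpace n} (hf : IsImmersionQProd I ε f)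
    (hsplit : ∀ x, IsSplittingAt I ε f x (ddt n) (T x) (η x)) (hT : ∀ x, T x ≠ 0)
    (hη : IsParallelNormalOn I ε f Set.univ η) (p : M) :
    IsParallelChart ε (f ∘ (extChartAt I p).symm) (η ∘ (extChartAt I p).symm)
      (extChartAt I p).target := by
  have : IsManifold I 1 M := IsManifold.of_le (n := ∞) (by simp)
  have hη' : ContMDiff I 𝓘(ℝ, AmbientSpace n) ∞ η := contMDiffOn_univ.1 hη.smooth
  have hfd := hf.mdifferentiableAt
  have hηd : ∀ x, MDifferentiableAt I 𝓘(ℝ, AmbientSpace n) η x :=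
    hη'.mdifferentiable (by simp)
  refine ⟨isOpen_extChartAt_target p, ?_, ?_, fun y _ => hf.mem _, fun y hy => ?_,
    fun y _ => (hη.normal _ trivial).1, fun y hy X => ?_, fun y hy => ?_, fun y hy X => ?_⟩
  · exact (hf.smooth.comp_contMDiffOn (contMDiffOn_extChartAt_symm p)).contDiffOn
  · exact (hη'.comp_contMDiffOn (contMDiffOn_extChartAt_symm p)).contDiffOn
  all_goals
    obtain ⟨L, hL⟩ := exists_fderiv_extChartAt_symm_eq (F := AmbientSpace n) (I := I) p hy
    have hLf := (hL f (hfd _)).2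
    have hLη := (hL η (hηd _)).2
  · intro X Y hXY
    rw [hLf, hLf] at hXY
    exact L.injective (hf.injective _ hXY)
  · rw [hLf]
    exact (hη.normal _ trivial).2 (L X)
  · refine ⟨L.symm (T ((extChartAt I p).symm y)), ?_, ?_⟩
    · exact fun h0 => hT _ (L.symm.map_eq_zero_iff.1 h0)
    · rw [hLf, L.apply_symm_apply]
      exact eq_sub_of_add_eq (hsplit _).1.symm
  · obtain ⟨Y, hY⟩ := hη.parallel _ trivial (L X)
    refine ⟨L.symm Y, ?_⟩
    rw [hLf, hLη, L.apply_symm_apply]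
    exact hY.1.trans (add_zero _)

variable {F : Type*} [NormedAddCommGroup F] [NormedSpace ℝ F]

/-- A local diffeomorphism from an open box `N × J` to the model space, composed with the inverse
of a chart. -/
def boxPartialDiffeomorph (p : M) (Φ : OpenPartialHomeomorph (F × ℝ) E)
    (N : TopologicalSpace.Opens F) (J : Set ℝ) (hN : Nonempty N)
    (hsrc : Φ.source = (N : Set F) ×ˢ J) (hJ : IsOpen J)
    (htgt : Φ.target ⊆ (extChartAt I p).target)
    (hΦ : ContDiffOn ℝ ∞ Φ Φ.source) (hΦ' : ContDiffOn ℝ ∞ Φ.symm Φ.target) :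
    PartialDiffeomorph (𝓘(ℝ, F).prod 𝓘(ℝ, ℝ)) I (N × ℝ) M ∞ where
  toFun q := (extChartAt I p).symm (Φ (q.1, q.2))
  invFun x := ((N.openPartialHomeomorphSubtypeCoe hN).symm (Φ.symm (extChartAt I p x)).1,
    (Φ.symm (extChartAt I p x)).2)
  source := Set.univ ×ˢ J
  target := (extChartAt I p).source ∩ extChartAt I p ⁻¹' Φ.target
  map_source' := by
    rintro ⟨u, s⟩ ⟨-, hs⟩
    have h1 : Φ (u, s) ∈ Φ.target := Φ.map_source (hsrc ▸ ⟨u.2, hs⟩)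
    refine ⟨(extChartAt I p).map_target (htgt h1), ?_⟩
    rw [Set.mem_preimage, (extChartAt I p).right_inv (htgt h1)]
    exact h1
  map_target' := by
    rintro x ⟨-, hx⟩
    have h1 : Φ.symm (extChartAt I p x) ∈ (N : Set F) ×ˢ J := hsrc ▸ Φ.map_target hx
    exact ⟨trivial, h1.2⟩
  left_inv' := by
    rintro ⟨u, s⟩ ⟨-, hs⟩
    have h0 : ((u : F), s) ∈ Φ.source := hsrc ▸ ⟨u.2, hs⟩
    have h1 : Φ (u, s) ∈ Φ.target := Φ.map_source h0
    simp only [(extChartAt I p).right_inv (htgt h1), Φ.left_inv h0]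
    exact Prod.ext ((N.openPartialHomeomorphSubtypeCoe hN).left_inv trivial) rfl
  right_inv' := by
    rintro x ⟨hx, hx'⟩
    have h1 : Φ.symm (extChartAt I p x) ∈ (N : Set F) ×ˢ J := hsrc ▸ Φ.map_target hx'
    have h2 : (((N.openPartialHomeomorphSubtypeCoe hN).symm (Φ.symm (extChartAt I p x)).1 : N) : F)
        = (Φ.symm (extChartAt I p x)).1 :=
      (N.openPartialHomeomorphSubtypeCoe hN).right_inv (by
        rw [N.openPartialHomeomorphSubtypeCoe_target]; exact h1.1)
    simp only [h2, Prod.mk.eta, Φ.right_inv hx', (extChartAt I p).left_inv hx]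
  open_source := isOpen_univ.prod hJ
  open_target := (continuousOn_extChartAt p).isOpen_inter_preimage (isOpen_extChartAt_source p)
    Φ.open_target
  contMDiffOn_toFun := by
    have h1 : ContMDiff (𝓘(ℝ, F).prod 𝓘(ℝ, ℝ)) 𝓘(ℝ, F × ℝ) ∞
        (fun q : N × ℝ => ((q.1 : F), q.2)) :=
      (contMDiff_subtype_val.comp contMDiff_fst).prodMk_space contMDiff_snd
    have h2 : Set.MapsTo (fun q : N × ℝ => ((q.1 : F), q.2)) (Set.univ ×ˢ J) Φ.source := by
      rintro ⟨u, s⟩ ⟨-, hs⟩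
      exact hsrc ▸ ⟨u.2, hs⟩
    exact (contMDiffOn_extChartAt_symm p).comp (hΦ.contMDiffOn.comp h1.contMDiffOn h2)
      fun q hq => htgt (Φ.map_source (h2 hq))
  contMDiffOn_invFun := by
    have h1 : ContMDiffOn I 𝓘(ℝ, F × ℝ) ∞ (fun x => Φ.symm (extChartAt I p x))
        ((extChartAt I p).source ∩ extChartAt I p ⁻¹' Φ.target) :=
      hΦ'.contMDiffOn.comp ((contMDiffOn_extChartAt (n := ∞) (I := I) (x := p)).mono (by
        rw [extChartAt_source]; exact Set.inter_subset_left)) fun x hx => hx.2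
    have h2 := contDiff_fst.contMDiff.comp_contMDiffOn h1
    have h3 := contDiff_snd.contMDiff.comp_contMDiffOn h1
    refine ContMDiffOn.prodMk (fun x hx => ?_) h3
    -- Smoothness into the open subset `N` is tested after inclusion in `F`, where the inverse of
    -- the inclusion disappears.
    rw [← ContMDiffWithinAt.subtypeVal_comp_iff]
    have h4 : ∀ z ∈ (extChartAt I p).source ∩ extChartAt I p ⁻¹' Φ.target,
        (Subtype.val ∘ fun x => (N.openPartialHomeomorphSubtypeCoe hN).symm
          (Φ.symm (extChartAt I p x)).1) z = (Φ.symm (extChartAt I p z)).1 := fun z hz => by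
      have h1 : Φ.symm (extChartAt I p z) ∈ (N : Set F) ×ˢ J := hsrc ▸ Φ.map_target hz.2
      exact (N.openPartialHomeomorphSubtypeCoe hN).right_inv (by
        rw [N.openPartialHomeomorphSubtypeCoe_target]; exact h1.1)
    exact (h2 x hx).congr h4 (h4 x hx)

end Transfer

end

/-! ### Assembly of the two implications -/

theorem corollary7 (ε : ℝ) (hε : ε = -1 ∨ ε = 0 ∨ ε = 1) (n : ℕ) :
    -- the construction, with `α` a geodesic
    (∀ (d k : ℕ) (N : Type*) [TopologicalSpace N] [ChartedSpace (EuclideanSpace ℝ (Fin d)) N]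
        [IsManifold (𝓡 d) ∞ N] (g : N → AmbientSpace n) (ξ : Fin k → N → AmbientSpace n)
        (α : ℝ → AmbientSpace k) (J : Set ℝ),
      IsTubeBase (𝓡 d) ε g ξ → IsTubeCurve ε α J → IsGeodesicOn ε α J →
        ContMDiffOn ((𝓡 d).prod 𝓘(ℝ, ℝ)) 𝓘(ℝ, AmbientSpace n) ∞ (tubeMap g ξ α)
          (Set.univ ×ˢ J) ∧
        Set.MapsTo (tubeMap g ξ α) (Set.univ ×ˢ J) (QProd ε n) ∧
        IsOpen (regularPoints (𝓡 d) (tubeMap g ξ α) J) ∧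
        ∃ (T : (q : N × ℝ) → TangentSpace ((𝓡 d).prod 𝓘(ℝ, ℝ)) q) (η : N × ℝ → AmbientSpace n),
          (∀ q ∈ regularPoints (𝓡 d) (tubeMap g ξ α) J,
            IsSplittingAt ((𝓡 d).prod 𝓘(ℝ, ℝ)) ε (tubeMap g ξ α) q (ddt n) (T q) (η q)) ∧
          IsParallelNormalOn ((𝓡 d).prod 𝓘(ℝ, ℝ)) ε (tubeMap g ξ α)
            (regularPoints (𝓡 d) (tubeMap g ξ α) J) η) ∧
    -- the converse
    (∀ (m : ℕ), 2 ≤ m → ∀ (M : Type*) [TopologicalSpace M]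
        [ChartedSpace (EuclideanSpace ℝ (Fin m)) M] [IsManifold (𝓡 m) ∞ M]
        (f : M → AmbientSpace n) (T : (x : M) → TangentSpace (𝓡 m) x) (η : M → AmbientSpace n),
      IsImmersionQProd (𝓡 m) ε f →
      (∀ x, IsSplittingAt (𝓡 m) ε f x (ddt n) (T x) (η x)) →
      (∀ x, T x ≠ 0) →
      IsParallelNormalOn (𝓡 m) ε f Set.univ η →
      ∀ p : M, ∃ (k : ℕ) (N : TopologicalSpace.Opens (EuclideanSpace ℝ (Fin (m - 1))))
        (g : N → AmbientSpace n) (ξ : Fin k → N → AmbientSpace n)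
        (α : ℝ → AmbientSpace k) (J : Set ℝ)
        (ψ : PartialDiffeomorph ((𝓡 (m - 1)).prod 𝓘(ℝ, ℝ)) (𝓡 m) (N × ℝ) M ∞),
        IsTubeBase (𝓡 (m - 1)) ε g ξ ∧ IsTubeCurve ε α J ∧ IsGeodesicOn ε α J ∧
        ψ.source = Set.univ ×ˢ J ∧ p ∈ ψ.target ∧
        ∀ q ∈ ψ.source, f (ψ q) = tubeMap g ξ α q) := by
  refine ⟨?_, ?_⟩
  · intro d k N _ _ _ g ξ α J hb hα hgeo
    obtain ⟨hsplit, hpar⟩ := isParallelNormalOn_tubeMap hε hb hα hgeo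
    exact ⟨contMDiffOn_tubeMap hb.immersion.smooth
      (fun i => contMDiffOn_univ.1 (hb.parallel i).smooth) hα.smooth,
      tubeMap_mem_QProd hε hb hα, isOpen_regularPoints hb hα, _, _, hsplit, hpar⟩
  · intro m hm M _ _ _ f T η hf hsplit hT hη p
    -- With `m = d + 1` the truncated difference `m - 1` reduces to `d` by definition.
    obtain ⟨d, rfl⟩ : ∃ d, m = d + 1 := ⟨m - 1, by omega⟩
    obtain ⟨k, N, g, ξ, α, J, Φ, hb, hα, hgeo, hsrc, hp, htgt, hΦ, hΦ', hfΦ⟩ :=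
      (isParallelChart_extChartAt hf hsplit hT hη p).exists_local_form
        (F := EuclideanSpace ℝ (Fin d)) hε (by simp) (mem_extChartAt_target (I := 𝓡 (d + 1)) p)
    have hq := Φ.map_target hp
    rw [hsrc] at hq
    exact ⟨k, N, g, ξ, α, J, boxPartialDiffeomorph p Φ N J ⟨_, hq.1⟩ hsrc hα.isOpen htgt hΦ hΦ',
      hb, hα, hgeo, rfl, ⟨mem_extChartAt_source p, hp⟩, fun q hq => hfΦ q.1 q.2 hq.2⟩
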